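/- **Notation.** Let $d\ge 1$. For $R>0$ let $D_R=\{z\in\mathbb C: |\Im z|<R\}$, and for $a\in\mathbb R$ let $\|a\|_{\mathbb T}=\inf_{k\in\mathbb Z}|a-k|$. For $n\in\mathbb Z^d$ put $|n|=\max_i|n_i|$, $\langle n\rangle=\max\{1,|n|\}$, $n\cdot\omega=\sum_i n_i\omega_i$. $\mathscr H_R$ is the set of bounded holomorphic functions of period $1$ on $D_R$. $\mathscr P_R$ is the set of meromorphic functions $g$ of period $1$ on $D_R$ for which there is $c>0$ with $|g(z)-g(z-a)|\ge c\|a\|_{\mathbb T}$ for all $a\in\mathbb R$ and all $z\in D_R$ such that neither $z$ nor $z-a$ is a pole of $g$; $|g|_R$ denotes the biggest such $c$. For $s\ge0$, $\mathscr U_{R,s}$ is the set of kernels $\mathcal M=(\mathcal M(z,n))_{z\in D_R,\,n\in\mathbb Z^d}$ with $\mathcal M(\cdot,n)\in\mathscr H_R$ for every $n$ and $$\|\mathcal M\|_{R,s}=\sup_{z\in D_R}\sum_{n\in\mathbb Z^d}|\mathcal M(z,n)|\langle n\rangle^s<\infty .$$ Given $\omega\in\mathbb R^d$, kernels are multiplied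 by $(\mathcal M_1\mathcal M_2)(z,n)=\sum_{l\in\mathbb Z^d}\mathcal M_1(z,l)\,\mathcal M_2(z-l\cdot\omega,n-l)$, and $\mathcal M^*(z,n)=\overline{\mathcal M(\bar z-n\cdot\omega,-n)}$. A function $f$ is identified with the diagonal kernel $f(z)\delta_{n0}$; the unit is $\mathbf 1(z,n)=\delta_{n0}$. A kernel $\mathcal M$ is self-adjoint if $\mathcal M^*=\mathcal M$ and unitary if $\mathcal M\mathcal M^*=\mathcal M^*\mathcal M=\mathbf 1$; a function $V$ is self-adjoint if $V^*=V$, where $V^*(z)=\overline{V(\bar z)}$. For $\gamma>0$ and $\tau>d$, $\mathrm{DC}_{\tau,\gamma}$ is the set of $\omega\in[0,1]^d$ with $\|n\cdot\omega\|_{\mathbb T}\ge\gamma\langle n\rangle^{-\tau}$ for all $n\in\mathbb Z^d\setminus\{0\}$. **Theorem.** Let $\gamma>0$, $\tau>d$, $\delta>0$, $\alpha_0>0$, $R>0$ and $\alpha>\alpha_0+\tau+4\delta$. There are constants $K_1,K_2>0$ depending only on $\alpha_0,\alpha,\delta$, and, for every $v>0$, some $\varepsilon_0=\varepsilon_0(R,\alpha,\alpha_0,\gamma,\tau,v,\delta)>0$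 such that the following holds. Let $\omega\in\mathrm{DC}_{\tau,\gamma}$, let $V\in\mathscr P_R$ with $|V|_R=v$, and let $\mathcal M\in\mathscr U_{R,\alpha+3\delta}$ with $\|\mathcal M\|_{R,\alpha+3\delta}<\varepsilon_0$. Then there are $\mathcal U\in\mathscr U_{R/2,\alpha-\tau-4\delta}$, invertible with inverse $\mathcal U^{-1}\in\mathscr U_{R/2,\alpha-\tau-4\delta}$, and $\hat V\in\mathscr P_{R/2}$ with $$\mathcal U(V+\mathcal M)\mathcal U^{-1}=\hat V,$$ $$\|\mathcal U^{\pm1}-\mathbf 1\|_{R/2,\alpha-\tau-4\delta}\le K_1\|\mathcal M\|_{R,\alpha+3\delta}^{3\delta/(\alpha-\alpha_0)},$$ $$V-\hat V\in\mathscr H_{R/2},\qquad |\hat V|_{R/2}\ge\tfrac12|V|_R,\qquad \|V-\hat V\|_{R/2,0}\le K_2\|\mathcal M\|_{R,\alpha+3\delta}.$$ Here the first identity holds at every $z\in D_{R/2}$ such that no $z-n\cdot\omega$, $n\in\mathbb Z^d$, is a pole of $V$; at these $z$ the product exists, with absolutely convergent series, for both ways of bracketing it, and both give $\hat V$. Moreover,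 if $\mathcal M$ and $V$ are self-adjoint, then $\mathcal U$ is unitary and $\hat V^*=\hat V$. -/

import Mathlib

open scoped ENNReal ComplexConjugate

namespace HolKernel

/-- The strip `D_R = {z : |Im z| < R}`. -/
def strip (R : ℝ) : Set ℂ := {z | |z.im| < R}

/-- The distance `‖a‖_𝕋 = inf_{k ∈ ℤ} |a - k|` of a real number to the integers, as the norm
of its class in `ℝ / ℤ`. -/
noncomputable def torusNorm (a : ℝ) : ℝ := ‖(a : UnitAddCircle)‖

/-- `𝓗_R`: the bounded holomorphic functions of period one on the strip `D_R`. Functions are total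
on `ℂ`; only their values on the strip matter. -/
structure IsHol (R : ℝ) (f : ℂ → ℂ) : Prop where
  periodic : ∀ z ∈ strip R, f (z + 1) = f z
  holomorphic : DifferentiableOn ℂ f (strip R)
  bounded : ∃ C : ℝ, ∀ z ∈ strip R, ‖f z‖ ≤ C

/-- The positive constants `c` with `|g(z) - g(z - a)| ≥ c ‖a‖_𝕋` for all real `a` and all `z` in
the strip `D_R`. Poles of `g` (for a meromorphic function in normal form these are the points where
`g` is not analytic) are left out: there the left side is understood to be infinite. -/
def monotoneConsts (R : ℝ) (g : ℂ → ℂ) : Set ℝ :=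
  {c | 0 < c ∧ ∀ z ∈ strip R, ∀ a : ℝ, AnalyticAt ℂ g z → AnalyticAt ℂ g (z - a) →
    c * torusNorm a ≤ ‖g z - g (z - a)‖}

/-- `𝓟_R`: the meromorphic functions `g` of period one on the strip `D_R` for which some `c > 0`
satisfies `|g(z) - g(z - a)| ≥ c ‖a‖_𝕋`. A meromorphic function is represented by the total function
in normal form: removable singularities are removed, and the value at a pole is `0`. -/
structure IsMonotonePotential (R : ℝ) (g : ℂ → ℂ) : Prop where
  meromorphic : MeromorphicNFOn g (strip R)
  periodic : ∀ z ∈ strip R, g (z + 1) = g z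
  monotone : (monotoneConsts R g).Nonempty

/-- `|g|_R`: the biggest constant `c` in the monotonicity condition. -/
noncomputable def monotoneConst (R : ℝ) (g : ℂ → ℂ) : ℝ := sSup (monotoneConsts R g)

/-- Kernels `𝓜(z, n)`, with `z ∈ ℂ` and `n ∈ ℤ^d`. -/
abbrev Kernel (d : ℕ) := ℂ → (Fin d → ℤ) → ℂ

/-- `⟨n⟩ = max {1, |n|}`, where `|n| = max_i |n_i|`. -/
noncomputable def bracket {d : ℕ} (n : Fin d → ℤ) : ℝ := max 1 ‖n‖

/-- `n · ω = ∑ n_i ω_i`. -/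
def dot {d : ℕ} (n : Fin d → ℤ) (ω : Fin d → ℝ) : ℝ := ∑ i, (n i : ℝ) * ω i

/-- `‖𝓜‖_{R,s} = sup_{z ∈ D_R} ∑_n |𝓜(z, n)| ⟨n⟩^s`, with values in `[0, ∞]`. -/
noncomputable def kernelNorm {d : ℕ} (R s : ℝ) (M : Kernel d) : ℝ≥0∞ :=
  ⨆ z ∈ strip R, ∑' n, ENNReal.ofReal (‖M z n‖ * bracket n ^ s)

/-- `𝓤_{R,s}`: the kernels with all `𝓜(·, n)` in `𝓗_R` and with `‖𝓜‖_{R,s} < ∞`. -/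
structure IsHolKernel {d : ℕ} (R s : ℝ) (M : Kernel d) : Prop where
  hol : ∀ n, IsHol R (fun z => M z n)
  finite : kernelNorm R s M < ⊤

/-- The diagonal kernel `f(z) δ_{n0}` of a function `f`. -/
def diag (d : ℕ) (f : ℂ → ℂ) : Kernel d := fun z n => if n = 0 then f z else 0

/-- The unit kernel `δ_{n0}`. -/
def unit (d : ℕ) : Kernel d := diag d (fun _ => 1)

/-- `C = A B` at the phases in `S`: for all `z ∈ S` and all `n`, the series
`∑_l A(z, l) B(z - l · ω, n - l)` converges absolutely, with sum `C(z, n)`. -/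
def IsProdOn {d : ℕ} (ω : Fin d → ℝ) (S : Set ℂ) (A B C : Kernel d) : Prop :=
  ∀ z ∈ S, ∀ n, HasSum (fun l : Fin d → ℤ => A z l * B (z - (dot l ω : ℂ)) (n - l)) (C z n)

/-- `D = A B C` at the phases in `S`: both `(A B) C` and `A (B C)` are given by absolutely
convergent series and are equal to `D`. -/
def IsTripleProdOn {d : ℕ} (ω : Fin d → ℝ) (S : Set ℂ) (A B C D : Kernel d) : Prop :=
  (∃ P : Kernel d, IsProdOn ω S A B P ∧ IsProdOn ω S P C D) ∧
  (∃ Q : Kernel d, IsProdOn ω S B C Q ∧ IsProdOn ω S A Q D)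

/-- The involution `𝓜^*(z, n) = conj 𝓜(conj z - n · ω, -n)`. -/
noncomputable def adjoint {d : ℕ} (ω : Fin d → ℝ) (M : Kernel d) : Kernel d :=
  fun z n => conj (M (conj z - (dot n ω : ℂ)) (-n))

/-- `𝓜 = 𝓜^*` on the strip `D_R`. -/
def IsSelfAdjointKernel {d : ℕ} (ω : Fin d → ℝ) (R : ℝ) (M : Kernel d) : Prop :=
  ∀ z ∈ strip R, ∀ n, adjoint ω M z n = M z n

/-- `𝓜 𝓜^* = 𝓜^* 𝓜 = 1` on the strip `D_R`. -/
def IsUnitaryKernel {d : ℕ} (ω : Fin d → ℝ) (R : ℝ) (M : Kernel d) : Prop :=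
  IsProdOn ω (strip R) M (adjoint ω M) (unit d) ∧ IsProdOn ω (strip R) (adjoint ω M) M (unit d)

/-- `V^* = V` on the strip `D_R`, where `V^*(z) = conj V(conj z)`. -/
def IsSelfAdjointPotential (R : ℝ) (V : ℂ → ℂ) : Prop :=
  ∀ z ∈ strip R, conj (V (conj z)) = V z

/-- The phases `z ∈ D_R` for which no `z - n · ω` is a pole of `V`. -/
def regularPhases {d : ℕ} (ω : Fin d → ℝ) (R : ℝ) (V : ℂ → ℂ) : Set ℂ :=
  {z | z ∈ strip R ∧ ∀ n : Fin d → ℤ, AnalyticAt ℂ V (z - (dot n ω : ℂ))}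

/-- The set `DC_{τ,γ}` of `(τ, γ)`-Diophantine frequencies in `[0,1]^d`. -/
def IsDiophantine {d : ℕ} (τ γ : ℝ) (ω : Fin d → ℝ) : Prop :=
  (∀ i, ω i ∈ Set.Icc (0 : ℝ) 1) ∧
  ∀ n : Fin d → ℤ, n ≠ 0 → γ / bracket n ^ τ ≤ torusNorm (dot n ω)

end HolKernel

open HolKernel

/-! To first order, conjugation by `1 + W` removes an off-diagonal entry `M(z,n)` from `V + M` when
`W(z,n) = M(z,n) / (V(z) - V(z - n·ω))`. Monotonicity and the Diophantine condition bound this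
divisor below by `vγ⟨n⟩^(-τ)` uniformly in `z`, so there are no resonances to exclude; the poles of
`V` do no harm, because a reciprocal that is bounded off them extends holomorphically
(`exists_holomorphic_reciprocal`). The diagonal part of `M` cannot be removed and is added to the
potential as a correction `f`. A Cauchy estimate on shrinking strips keeps the Lipschitz constant of
`f` under real shifts below `v/2`, so `V + f` stays monotone with half the constant.

Each division loses `τ` powers of `⟨n⟩`. Step `k` therefore treats only `⟨n⟩ ≤ B^(k+1)` and measures
the remainder with the weight `2^s (1 + B^(-sk) ⟨n⟩^s)`. These weights are submultiplicative for
every `k`, and beyond the cut-off the passage to the next one gains a factor `2y`, where `y =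
B^(-s)`. The quadratic errors fit into the same gain, so the remainder decays like `(4y)^k`. The
divisors cost powers of `x = B^τ`, and the return to the weight `⟨n⟩^σ` costs powers of `u = B^σ`.
As `s = σ + τ + η`, the product `yxu = B^(-η)` is as small as needed for a suitable `B`, and the
transformations converge in the `σ`-norm. Geometric convergence is enough. One step is
`exists_conjugation_step`, its bookkeeping `iterationState_step`, the limit
`exists_isDiagonalization`.

The bounded kernels form a Banach algebra `BKernel`, but `V` is unbounded and lies outside it. It
enters only through `HasCommutator`, at phases whose orbit avoids the poles; these are dense, so
identities between holomorphic functions extend from them to the strip.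

If `V` and `M` are self-adjoint and `U (V + M) = p U` with `p = V + f`, then `G = U U^*` satisfies
`p G = G p^*`. The entry at `n = 0` gives `p = p^*`, and separation of the values of `p` makes `G`
diagonal (`IsDiagonalization.gram`). Since `G` is close to one, `G^(-1/2) U` is defined, is unitary,
and diagonalizes to the same potential (`IsDiagonalization.exists_unitary`). -/

namespace HolKernel

open Filter Topology

/-! ### Kernels, weighted norms and the twisted product -/

section Kernels

variable {d : ℕ} {ω : Fin d → ℝ}

lemma dot_add (l m : Fin d → ℤ) (ω : Fin d → ℝ) : dot (l + m) ω = dot l ω + dot m ω := by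
  simp [dot, add_mul, Finset.sum_add_distrib]

lemma dot_neg (l : Fin d → ℤ) (ω : Fin d → ℝ) : dot (-l) ω = -dot l ω := by
  simp [dot]

lemma dot_sub (l m : Fin d → ℤ) (ω : Fin d → ℝ) : dot (l - m) ω = dot l ω - dot m ω := by
  rw [sub_eq_add_neg, dot_add, dot_neg, sub_eq_add_neg]

@[simp] lemma dot_zero (ω : Fin d → ℝ) : dot 0 ω = 0 := by simp [dot]

lemma summable_of_tsum_enorm_ne_top {ι : Type*} {f : ι → ℂ} (h : ∑' i, ‖f i‖ₑ ≠ ⊤) :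
    Summable f := by
  refine Summable.of_nnnorm ?_
  exact ENNReal.tsum_coe_ne_top_iff_summable.1 h

/-- The norm `sup_z ∑_n |A(z, n)| w(n)` for a weight `w`. -/
noncomputable def wnorm (w : (Fin d → ℤ) → ℝ≥0∞) (A : Kernel d) : ℝ≥0∞ :=
  ⨆ z, ∑' n, ‖A z n‖ₑ * w n

lemma row_le_wnorm (w : (Fin d → ℤ) → ℝ≥0∞) (A : Kernel d) (z : ℂ) :
    ∑' n, ‖A z n‖ₑ * w n ≤ wnorm w A := le_iSup (fun z => ∑' n, ‖A z n‖ₑ * w n) z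

lemma entry_le_wnorm (w : (Fin d → ℤ) → ℝ≥0∞) (A : Kernel d) (z : ℂ) (n : Fin d → ℤ) :
    ‖A z n‖ₑ * w n ≤ wnorm w A :=
  (ENNReal.le_tsum (f := fun n => ‖A z n‖ₑ * w n) n).trans (row_le_wnorm w A z)

lemma wnorm_mono {w : (Fin d → ℤ) → ℝ≥0∞} {A B : Kernel d}
    (h : ∀ z n, ‖A z n‖ₑ * w n ≤ ‖B z n‖ₑ * w n) : wnorm w A ≤ wnorm w B :=
  iSup_mono fun z => ENNReal.tsum_le_tsum fun n => h z n

lemma wnorm_le_mul_wnorm {w w' : (Fin d → ℤ) → ℝ≥0∞} {A B : Kernel d} {c : ℝ≥0∞}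
    (h : ∀ z n, ‖A z n‖ₑ * w n ≤ c * (‖B z n‖ₑ * w' n)) : wnorm w A ≤ c * wnorm w' B := by
  refine iSup_le fun z => ?_
  calc ∑' n, ‖A z n‖ₑ * w n ≤ ∑' n, c * (‖B z n‖ₑ * w' n) := ENNReal.tsum_le_tsum fun n => h z n
    _ = c * ∑' n, ‖B z n‖ₑ * w' n := ENNReal.tsum_mul_left
    _ ≤ _ := by gcongr; exact row_le_wnorm w' B z

lemma wnorm_weight_mono {w w' : (Fin d → ℤ) → ℝ≥0∞} (h : ∀ n, w n ≤ w' n) (A : Kernel d) :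
    wnorm w A ≤ wnorm w' A :=
  iSup_mono fun z => ENNReal.tsum_le_tsum fun n => by gcongr; exact h n

lemma wnorm_add_le (w : (Fin d → ℤ) → ℝ≥0∞) (A B : Kernel d) :
    wnorm w (A + B) ≤ wnorm w A + wnorm w B := by
  refine iSup_le fun z => ?_
  calc ∑' n, ‖(A + B) z n‖ₑ * w n ≤ ∑' n, (‖A z n‖ₑ * w n + ‖B z n‖ₑ * w n) := by
        refine ENNReal.tsum_le_tsum fun n => ?_
        rw [← add_mul]
        gcongr
        exact enorm_add_le _ _
    _ = ∑' n, ‖A z n‖ₑ * w n + ∑' n, ‖B z n‖ₑ * w n := ENNReal.tsum_add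
    _ ≤ _ := add_le_add (row_le_wnorm w A z) (row_le_wnorm w B z)

lemma wnorm_neg (w : (Fin d → ℤ) → ℝ≥0∞) (A : Kernel d) : wnorm w (-A) = wnorm w A := by
  simp [wnorm]

lemma wnorm_sub_le (w : (Fin d → ℤ) → ℝ≥0∞) (A B : Kernel d) :
    wnorm w (A - B) ≤ wnorm w A + wnorm w B := by
  rw [sub_eq_add_neg, ← wnorm_neg w B]
  exact wnorm_add_le w A (-B)

@[simp] lemma wnorm_zero (w : (Fin d → ℤ) → ℝ≥0∞) : wnorm w (0 : Kernel d) = 0 := by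
  simp [wnorm]

lemma row_diag (w : (Fin d → ℤ) → ℝ≥0∞) (f : ℂ → ℂ) (z : ℂ) :
    ∑' n, ‖diag d f z n‖ₑ * w n = ‖f z‖ₑ * w 0 := by
  rw [tsum_eq_single 0 (fun n hn => by simp [diag, hn])]
  simp [diag]

lemma wnorm_unit (w : (Fin d → ℤ) → ℝ≥0∞) : wnorm w (unit d) = w 0 := by
  simp only [wnorm, unit, row_diag]
  simp

/-- A weight: a submultiplicative function on `ℤ^d` that is at least one. -/
structure IsWeight (w : (Fin d → ℤ) → ℝ≥0∞) : Prop where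
  one_le : ∀ n, 1 ≤ w n
  mul_le : ∀ n m, w (n + m) ≤ w n * w m

lemma isWeight_one : IsWeight (1 : (Fin d → ℤ) → ℝ≥0∞) := ⟨fun _ => le_rfl, fun _ _ => by simp⟩

/-- The kernel product. -/
noncomputable def kmul (ω : Fin d → ℝ) (A B : Kernel d) : Kernel d :=
  fun z n => ∑' l, A z l * B (z - (dot l ω : ℂ)) (n - l)

/-- Submultiplicativity splits the weight along `n = l + (n - l)`. After the sums are interchanged,
the inner row is taken at the phase `z - l·ω`; the shift is harmless because the norm is a supremum
over all phases. -/
lemma wnorm_kmul_le {w : (Fin d → ℤ) → ℝ≥0∞} (hw : IsWeight w) (A B : Kernel d) :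
    wnorm w (kmul ω A B) ≤ wnorm w A * wnorm w B := by
  refine iSup_le fun z => ?_
  calc ∑' n, ‖kmul ω A B z n‖ₑ * w n
      ≤ ∑' n, ∑' l, (‖A z l‖ₑ * w l) * (‖B (z - (dot l ω : ℂ)) (n - l)‖ₑ * w (n - l)) := by
        refine ENNReal.tsum_le_tsum fun n => ?_
        calc ‖kmul ω A B z n‖ₑ * w n
            ≤ (∑' l, ‖A z l * B (z - (dot l ω : ℂ)) (n - l)‖ₑ) * w n := by
              gcongr; exact enorm_tsum_le_tsum_enorm
          _ = ∑' l, ‖A z l * B (z - (dot l ω : ℂ)) (n - l)‖ₑ * w n := ENNReal.tsum_mul_right.symm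
          _ ≤ _ := by
              refine ENNReal.tsum_le_tsum fun l => ?_
              rw [enorm_mul, mul_mul_mul_comm]
              gcongr
              simpa using hw.mul_le l (n - l)
    _ = ∑' l, ∑' n, (‖A z l‖ₑ * w l) * (‖B (z - (dot l ω : ℂ)) (n - l)‖ₑ * w (n - l)) :=
        ENNReal.tsum_comm
    _ = ∑' l, (‖A z l‖ₑ * w l) * ∑' n, ‖B (z - (dot l ω : ℂ)) n‖ₑ * w n := by
        refine tsum_congr fun l => ?_
        rw [ENNReal.tsum_mul_left]
        congr 1
        exact (Equiv.subRight l).tsum_eq (fun n => ‖B (z - (dot l ω : ℂ)) n‖ₑ * w n)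
    _ ≤ ∑' l, (‖A z l‖ₑ * w l) * wnorm w B := by
        refine ENNReal.tsum_le_tsum fun l => ?_
        gcongr
        exact row_le_wnorm w B _
    _ = (∑' l, ‖A z l‖ₑ * w l) * wnorm w B := ENNReal.tsum_mul_right
    _ ≤ _ := by gcongr; exact row_le_wnorm w A z

lemma tsum_enorm_row_lt_top {A : Kernel d} (hA : wnorm 1 A < ⊤) (z : ℂ) :
    ∑' n, ‖A z n‖ₑ < ⊤ := by
  have := (row_le_wnorm 1 A z).trans_lt hA
  simpa using this

lemma exists_bound_of_wnorm_lt_top {A : Kernel d} (hA : wnorm 1 A < ⊤) :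
    ∃ K : ℝ, ∀ z n, ‖A z n‖ ≤ K := by
  refine ⟨(wnorm 1 A).toReal, fun z n => ?_⟩
  have := entry_le_wnorm 1 A z n
  simp only [Pi.one_apply, mul_one] at this
  rw [← toReal_enorm]
  exact ENNReal.toReal_mono hA.ne this

lemma tsum_tsum_enorm_ne_top {A B C : Kernel d} (hA : wnorm 1 A < ⊤) (hB : wnorm 1 B < ⊤)
    (hC : ∃ K : ℝ, ∀ z n, ‖C z n‖ ≤ K) (z : ℂ) (n : Fin d → ℤ) :
    ∑' p : (Fin d → ℤ) × (Fin d → ℤ), ‖A z p.1 * B (z - (dot p.1 ω : ℂ)) (p.2 - p.1) *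
      C (z - (dot p.2 ω : ℂ)) (n - p.2)‖ₑ ≠ ⊤ := by
  obtain ⟨K, hK⟩ := hC
  have key : ∀ l m : Fin d → ℤ, ‖A z l * B (z - (dot l ω : ℂ)) (m - l) *
      C (z - (dot m ω : ℂ)) (n - m)‖ₑ ≤
      ‖A z l‖ₑ * (‖B (z - (dot l ω : ℂ)) (m - l)‖ₑ * ENNReal.ofReal K) := by
    intro l m
    rw [enorm_mul, enorm_mul, mul_assoc]
    gcongr
    rw [← ofReal_norm]
    exact ENNReal.ofReal_le_ofReal (hK _ _)
  refine ne_top_of_le_ne_top (b := wnorm 1 A * (wnorm 1 B * ENNReal.ofReal K)) ?_ ?_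
  · exact ENNReal.mul_ne_top hA.ne (ENNReal.mul_ne_top hB.ne ENNReal.ofReal_ne_top)
  rw [ENNReal.tsum_prod']
  calc _ ≤ ∑' l, ∑' m, ‖A z l‖ₑ * (‖B (z - (dot l ω : ℂ)) (m - l)‖ₑ * ENNReal.ofReal K) :=
        ENNReal.tsum_le_tsum fun l => ENNReal.tsum_le_tsum fun m => key l m
    _ = ∑' l, ‖A z l‖ₑ * ((∑' m, ‖B (z - (dot l ω : ℂ)) m‖ₑ) * ENNReal.ofReal K) := by
        refine tsum_congr fun l => ?_
        rw [ENNReal.tsum_mul_left, ENNReal.tsum_mul_right]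
        congr 2
        exact (Equiv.subRight l).tsum_eq (fun m => ‖B (z - (dot l ω : ℂ)) m‖ₑ)
    _ ≤ ∑' l, ‖A z l‖ₑ * (wnorm 1 B * ENNReal.ofReal K) := by
        refine ENNReal.tsum_le_tsum fun l => ?_
        gcongr
        simpa using row_le_wnorm 1 B (z - (dot l ω : ℂ))
    _ = (∑' l, ‖A z l‖ₑ) * (wnorm 1 B * ENNReal.ofReal K) := ENNReal.tsum_mul_right
    _ ≤ _ := by
        gcongr
        simpa using row_le_wnorm 1 A z

lemma summable_kmul {A B : Kernel d} (hA : wnorm 1 A < ⊤) (hB : ∃ K : ℝ, ∀ z n, ‖B z n‖ ≤ K)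
    (z : ℂ) (n : Fin d → ℤ) : Summable fun l => A z l * B (z - (dot l ω : ℂ)) (n - l) := by
  obtain ⟨K, hK⟩ := hB
  have h1 : Summable fun l => ‖A z l‖ := by
    have := (tsum_enorm_row_lt_top hA z).ne
    exact ENNReal.tsum_coe_ne_top_iff_summable_coe.1 this
  refine Summable.of_norm_bounded (h1.mul_right K) fun l => ?_
  rw [norm_mul]
  gcongr
  exact hK _ _

lemma hasSum_kmul {A B : Kernel d} (hA : wnorm 1 A < ⊤) (hB : ∃ K : ℝ, ∀ z n, ‖B z n‖ ≤ K)
    (z : ℂ) (n : Fin d → ℤ) :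
    HasSum (fun l => A z l * B (z - (dot l ω : ℂ)) (n - l)) (kmul ω A B z n) :=
  (summable_kmul hA hB z n).hasSum

/-- Fubini over pairs `(l, m)`. Entrywise bounds on `C` suffice, which matters when `C` is an
adjoint: its row sums are not controlled by those of the original kernel. -/
lemma kmul_assoc {A B C : Kernel d} (hA : wnorm 1 A < ⊤) (hB : wnorm 1 B < ⊤)
    (hC : ∃ K : ℝ, ∀ z n, ‖C z n‖ ≤ K) :
    kmul ω (kmul ω A B) C = kmul ω A (kmul ω B C) := by
  funext z n
  have hs := summable_of_tsum_enorm_ne_top (tsum_tsum_enorm_ne_top (ω := ω) hA hB hC z n)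
  calc kmul ω (kmul ω A B) C z n
      = ∑' m, ∑' l, A z l * B (z - (dot l ω : ℂ)) (m - l) * C (z - (dot m ω : ℂ)) (n - m) :=
        tsum_congr fun m => tsum_mul_right.symm
    _ = ∑' l, ∑' m, A z l * B (z - (dot l ω : ℂ)) (m - l) * C (z - (dot m ω : ℂ)) (n - m) :=
        hs.tsum_comm
    _ = _ := by
        refine tsum_congr fun l => ?_
        simp only [mul_assoc]
        rw [tsum_mul_left]
        congr 1
        refine Eq.trans ?_ ((Equiv.subRight l).tsum_eq fun m => B (z - (dot l ω : ℂ)) m *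
          C (z - (dot l ω : ℂ) - (dot m ω : ℂ)) (n - l - m))
        refine tsum_congr fun m => ?_
        simp only [Equiv.subRight_apply, dot_sub, Complex.ofReal_sub]
        congr 2
        · ring
        · abel

end Kernels

/-! ### The Banach algebra of bounded kernels -/

section Ring

variable {d : ℕ} {ω : Fin d → ℝ}

/-- The Banach algebra over the frequency `ω` of the kernels with `sup_z ∑_n |A(z, n)| < ∞`. -/
structure BKernel {d : ℕ} (ω : Fin d → ℝ) where
  /-- The underlying kernel. -/
  val : Kernel d
  finite : wnorm 1 val < ⊤

namespace BKernel

instance : CoeFun (BKernel ω) (fun _ => Kernel d) := ⟨BKernel.val⟩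

lemma val_injective : Function.Injective (BKernel.val : BKernel ω → Kernel d) := by
  rintro ⟨A, hA⟩ ⟨B, hB⟩ rfl
  rfl

@[ext] lemma ext {A B : BKernel ω} (h : ∀ z n, A z n = B z n) : A = B :=
  val_injective (funext fun z => funext fun n => h z n)

lemma exists_bound (A : BKernel ω) : ∃ K : ℝ, ∀ z n, ‖A z n‖ ≤ K :=
  exists_bound_of_wnorm_lt_top A.finite

instance : Zero (BKernel ω) := ⟨⟨0, by simp⟩⟩
instance : One (BKernel ω) := ⟨⟨unit d, by rw [wnorm_unit]; simp⟩⟩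
noncomputable instance : Add (BKernel ω) := ⟨fun A B => ⟨A.1 + B.1,
  (wnorm_add_le 1 A.1 B.1).trans_lt (ENNReal.add_lt_top.2 ⟨A.2, B.2⟩)⟩⟩
noncomputable instance : Neg (BKernel ω) := ⟨fun A => ⟨-A.1, by rw [wnorm_neg]; exact A.2⟩⟩
noncomputable instance : Mul (BKernel ω) := ⟨fun A B => ⟨kmul ω A.1 B.1,
  (wnorm_kmul_le isWeight_one A.1 B.1).trans_lt (ENNReal.mul_lt_top A.2 B.2)⟩⟩

lemma hasSum_mul (A B : BKernel ω) (z : ℂ) (n : Fin d → ℤ) :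
    HasSum (fun l => A z l * B (z - (dot l ω : ℂ)) (n - l)) ((A * B) z n) :=
  hasSum_kmul A.2 B.exists_bound z n

end BKernel

lemma kmul_diag_left (f : ℂ → ℂ) (B : Kernel d) (z : ℂ) (n : Fin d → ℤ) :
    kmul ω (diag d f) B z n = f z * B z n := by
  rw [kmul, tsum_eq_single 0 (fun l hl => by simp [diag, hl])]
  simp [diag]

lemma kmul_diag_right (f : ℂ → ℂ) (A : Kernel d) (z : ℂ) (n : Fin d → ℤ) :
    kmul ω A (diag d f) z n = A z n * f (z - (dot n ω : ℂ)) := by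
  rw [kmul, tsum_eq_single n (fun l hl => by
    have : n - l ≠ 0 := fun h => hl (sub_eq_zero.1 h).symm
    simp [diag, this])]
  simp [diag]

namespace BKernel

noncomputable instance : Ring (BKernel ω) := Ring.ofMinimalAxioms
  (fun A B C => val_injective (add_assoc A.1 B.1 C.1))
  (fun A => val_injective (zero_add A.1))
  (fun A => val_injective (neg_add_cancel A.1))
  (fun A B C => val_injective (kmul_assoc A.2 B.2 C.exists_bound))
  (fun A => by
    ext z n
    exact (kmul_diag_left _ _ _ _).trans (one_mul _))
  (fun A => by
    ext z n
    exact (kmul_diag_right _ _ _ _).trans (mul_one _))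
  (fun A B C => by
    ext z n
    refine (A.hasSum_mul (B + C) z n).unique ?_
    refine HasSum.congr_fun ((A.hasSum_mul B z n).add (A.hasSum_mul C z n)) fun l => ?_
    exact mul_add _ _ _)
  (fun A B C => by
    ext z n
    refine ((A + B).hasSum_mul C z n).unique ?_
    refine HasSum.congr_fun ((A.hasSum_mul C z n).add (B.hasSum_mul C z n)) fun l => ?_
    exact add_mul _ _ _)

@[simp] lemma coe_add (A B : BKernel ω) : (A + B).1 = A.1 + B.1 := rfl
@[simp] lemma coe_neg (A : BKernel ω) : (-A).1 = -A.1 := rfl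
@[simp] lemma coe_sub (A B : BKernel ω) : (A - B).1 = A.1 - B.1 := by
  rw [sub_eq_add_neg A B, sub_eq_add_neg A.1 B.1]; rfl
@[simp] lemma coe_zero : (0 : BKernel ω).1 = 0 := rfl
@[simp] lemma coe_mul (A B : BKernel ω) : (A * B).1 = kmul ω A.1 B.1 := rfl
@[simp] lemma coe_one : (1 : BKernel ω).1 = unit d := rfl

lemma eq_zero_of_wnorm_eq_zero {A : BKernel ω} (h : wnorm 1 A.1 = 0) : A = 0 := by
  ext z n
  have := entry_le_wnorm 1 A.1 z n
  rw [h] at this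
  simpa using this

noncomputable instance : NormedRing (BKernel ω) :=
  RingNorm.toNormedRing
    { toFun := fun A => (wnorm 1 A.1).toReal
      map_zero' := by simp
      add_le' := fun A B => by
        rw [← ENNReal.toReal_add A.2.ne B.2.ne]
        exact ENNReal.toReal_mono (ENNReal.add_lt_top.2 ⟨A.2, B.2⟩).ne (wnorm_add_le 1 A.1 B.1)
      neg' := fun A => by simp [wnorm_neg]
      mul_le' := fun A B => by
        rw [← ENNReal.toReal_mul]
        exact ENNReal.toReal_mono (ENNReal.mul_lt_top A.2 B.2).ne
          (wnorm_kmul_le isWeight_one A.1 B.1)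
      eq_zero_of_map_eq_zero' := fun A hA => by
        rw [ENNReal.toReal_eq_zero_iff, or_iff_left A.2.ne] at hA
        exact eq_zero_of_wnorm_eq_zero hA }

lemma norm_def (A : BKernel ω) : ‖A‖ = (wnorm 1 A.1).toReal := rfl

lemma norm_le_of_wnorm_le {w : (Fin d → ℤ) → ℝ≥0∞} (hw : ∀ n, 1 ≤ w n) {A : BKernel ω} {a : ℝ}
    (ha : 0 ≤ a) (h : wnorm w A.1 ≤ ENNReal.ofReal a) : ‖A‖ ≤ a := by
  rw [norm_def]
  exact ENNReal.toReal_le_of_le_ofReal ha ((wnorm_weight_mono hw A.1).trans h)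

lemma entry_le_norm (A : BKernel ω) (z : ℂ) (n : Fin d → ℤ) : ‖A z n‖ ≤ ‖A‖ := by
  rw [norm_def, ← toReal_enorm]
  refine ENNReal.toReal_mono A.2.ne ?_
  simpa using entry_le_wnorm 1 A.1 z n

lemma tendsto_entry {ι : Type*} {F : Filter ι} {u : ι → BKernel ω} {A : BKernel ω}
    (h : Tendsto u F (𝓝 A)) (z : ℂ) (n : Fin d → ℤ) :
    Tendsto (fun i => u i z n) F (𝓝 (A z n)) := by
  rw [tendsto_iff_norm_sub_tendsto_zero] at h ⊢
  exact squeeze_zero (fun i => norm_nonneg _) (fun i => by simpa using! entry_le_norm (u i - A) z n) h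

/-- Weighted balls are closed under entrywise limits. -/
lemma wnorm_le_of_tendsto_entry {ι : Type*} {F : Filter ι} [F.NeBot] {u : ι → Kernel d}
    {A : Kernel d} (h : ∀ z n, Tendsto (fun i => u i z n) F (𝓝 (A z n)))
    {w : (Fin d → ℤ) → ℝ≥0∞} (hw : ∀ n, w n ≠ ⊤)
    {c : ℝ≥0∞} (hc : ∀ᶠ i in F, wnorm w (u i) ≤ c) : wnorm w A ≤ c := by
  refine iSup_le fun z => ?_
  rw [ENNReal.tsum_eq_iSup_sum]
  refine iSup_le fun s => ?_
  have : Tendsto (fun i => ∑ n ∈ s, ‖u i z n‖ₑ * w n) F (𝓝 (∑ n ∈ s, ‖A z n‖ₑ * w n)) := by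
    refine tendsto_finsetSum _ fun n _ => ?_
    exact ENNReal.Tendsto.mul_const ((continuous_enorm.tendsto _).comp (h z n))
      (Or.inr (hw n))
  refine le_of_tendsto this (hc.mono fun i hi => ?_)
  exact (ENNReal.sum_le_tsum s).trans ((row_le_wnorm w (u i) z).trans hi)

/-- Entries of a Cauchy sequence converge, and norm balls are closed under entrywise limits, so the
entrywise limit is the norm limit. -/
instance : CompleteSpace (BKernel ω) := by
  refine Metric.complete_of_cauchySeq_tendsto fun u hu => ?_
  have hent : ∀ z n, CauchySeq fun i => u i z n := by
    intro z n
    rw [Metric.cauchySeq_iff] at hu ⊢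
    intro ε hε
    obtain ⟨N, hN⟩ := hu ε hε
    refine ⟨N, fun i hi j hj => ?_⟩
    have h1 := hN i hi j hj
    rw [dist_eq_norm] at h1 ⊢
    have h2 := entry_le_norm (u i - u j) z n
    rw [coe_sub] at h2
    exact h2.trans_lt h1
  choose A hA using fun z n => cauchySeq_tendsto_of_complete (hent z n)
  have hdist : ∀ ε > 0, ∃ N, ∀ i ≥ N, wnorm 1 ((u i).1 - A) ≤ ENNReal.ofReal ε := by
    intro ε hε
    rw [Metric.cauchySeq_iff] at hu
    obtain ⟨N, hN⟩ := hu ε hε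
    refine ⟨N, fun i hi => ?_⟩
    refine wnorm_le_of_tendsto_entry (F := atTop) (u := fun j => (u i).1 - (u j).1)
      (fun z n => (hA z n).const_sub _) (fun n => by simp) ?_
    filter_upwards [eventually_ge_atTop N] with j hj
    have h1 := (hN i hi j hj).le
    rw [dist_eq_norm, norm_def] at h1
    rw [← coe_sub]
    exact (ENNReal.le_ofReal_iff_toReal_le (u i - u j).2.ne hε.le).2 h1
  have hfin : wnorm 1 A < ⊤ := by
    obtain ⟨N, hN⟩ := hdist 1 one_pos
    have : A = (u N).1 - ((u N).1 - A) := by abel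
    rw [this]
    refine (wnorm_sub_le 1 _ _).trans_lt (ENNReal.add_lt_top.2 ⟨(u N).2, ?_⟩)
    exact (hN N le_rfl).trans_lt ENNReal.ofReal_lt_top
  refine ⟨⟨A, hfin⟩, ?_⟩
  rw [Metric.tendsto_atTop]
  intro ε hε
  obtain ⟨N, hN⟩ := hdist (ε / 2) (half_pos hε)
  refine ⟨N, fun i hi => ?_⟩
  rw [dist_eq_norm]
  refine lt_of_le_of_lt ?_ (half_lt_self hε)
  rw [norm_def, coe_sub]
  exact ENNReal.toReal_le_of_le_ofReal (half_pos hε).le (hN i hi)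

lemma wnorm_le_of_tendsto {u : ℕ → BKernel ω}
    {A : BKernel ω} (h : Tendsto u atTop (𝓝 A))
    {w : (Fin d → ℤ) → ℝ≥0∞} (hw : ∀ n, w n ≠ ⊤)
    {c : ℝ≥0∞} (hc : ∀ᶠ i in atTop, wnorm w (u i).1 ≤ c) : wnorm w A.1 ≤ c :=
  wnorm_le_of_tendsto_entry (tendsto_entry h) hw hc

lemma wnorm_mul_le {w : (Fin d → ℤ) → ℝ≥0∞} (hw : IsWeight w) {A B : BKernel ω} {a b : ℝ}
    (ha : 0 ≤ a)
    (hA : wnorm w A.1 ≤ ENNReal.ofReal a) (hB : wnorm w B.1 ≤ ENNReal.ofReal b) :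
    wnorm w (A * B).1 ≤ ENNReal.ofReal (a * b) := by
  rw [ENNReal.ofReal_mul ha]
  exact (wnorm_kmul_le hw _ _).trans (mul_le_mul' hA hB)

lemma wnorm_add_le {w : (Fin d → ℤ) → ℝ≥0∞} {A B : BKernel ω} {a b : ℝ}
    (ha : 0 ≤ a) (hb : 0 ≤ b)
    (hA : wnorm w A.1 ≤ ENNReal.ofReal a) (hB : wnorm w B.1 ≤ ENNReal.ofReal b) :
    wnorm w (A + B).1 ≤ ENNReal.ofReal (a + b) := by
  rw [ENNReal.ofReal_add ha hb]
  exact (HolKernel.wnorm_add_le w _ _).trans (add_le_add hA hB)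

lemma wnorm_sub_le {w : (Fin d → ℤ) → ℝ≥0∞} {A B : BKernel ω} {a b : ℝ}
    (ha : 0 ≤ a) (hb : 0 ≤ b)
    (hA : wnorm w A.1 ≤ ENNReal.ofReal a) (hB : wnorm w B.1 ≤ ENNReal.ofReal b) :
    wnorm w (A - B).1 ≤ ENNReal.ofReal (a + b) := by
  rw [ENNReal.ofReal_add ha hb, coe_sub]
  exact (HolKernel.wnorm_sub_le w _ _).trans (add_le_add hA hB)

/-- Neumann series: `1 + A` is invertible if `A` is small in some weighted norm, and the inverse
is as close to the unit. -/
lemma exists_inverse_one_add {w : (Fin d → ℤ) → ℝ≥0∞} (hw : IsWeight w) (hw' : ∀ n, w n ≠ ⊤)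
    {A : BKernel ω} {a : ℝ}
    (ha : 0 ≤ a) (ha2 : a ≤ 1 / 2) (hA : wnorm w A.1 ≤ ENNReal.ofReal a)
    (T : Subring (BKernel ω)) (hT : IsClosed (T : Set (BKernel ω))) (hAT : A ∈ T) :
    ∃ Y : BKernel ω, Y ∈ T ∧ wnorm w Y.1 ≤ ENNReal.ofReal (2 * a) ∧
      (1 + A) * (1 + Y) = 1 ∧ (1 + Y) * (1 + A) = 1 := by
  have hnorm : ‖-A‖ < 1 := by
    rw [norm_neg]
    exact (norm_le_of_wnorm_le hw.one_le ha hA).trans_lt (by linarith)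
  have hs := summable_geometric_of_norm_lt_one hnorm
  have h1 := mul_neg_geom_series (-A) hnorm
  have h2 := geom_series_mul_neg (-A) hnorm
  rw [sub_neg_eq_add] at h1 h2
  set X : BKernel ω := ∑' i : ℕ, (-A) ^ i with hX
  -- The series converges in the unweighted norm. Its partial sums without the zeroth term have
  -- `w`-norm at most `a + a² + ⋯ ≤ 2a`, a bound that survives the limit.
  have hY : HasSum (fun i : ℕ => (-A) ^ (i + 1)) (X - 1) := by
    have := (hasSum_nat_add_iff' 1).2 hs.hasSum
    simpa using this
  refine ⟨X - 1, ?_, ?_, ?_, ?_⟩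
  · refine hT.mem_of_tendsto hY.tendsto_sum_nat (Eventually.of_forall fun k => ?_)
    exact T.sum_mem fun i _ => T.pow_mem (T.neg_mem hAT) _
  · refine wnorm_le_of_tendsto hY.tendsto_sum_nat hw' (Eventually.of_forall fun k => ?_)
    have hpow : ∀ i : ℕ, wnorm w ((-A) ^ (i + 1) : BKernel ω).1 ≤ ENNReal.ofReal (a ^ (i + 1)) := by
      intro i
      induction i with
      | zero => simpa [wnorm_neg] using hA
      | succ i ih =>
        rw [pow_succ, pow_succ a]
        exact wnorm_mul_le hw (by positivity) ih (by simpa [wnorm_neg] using hA)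
    have hsum : wnorm w (∑ i ∈ Finset.range k, (-A) ^ (i + 1) : BKernel ω).1 ≤
        ENNReal.ofReal (∑ i ∈ Finset.range k, a ^ (i + 1)) := by
      induction k with
      | zero => simp
      | succ k ih =>
        rw [Finset.sum_range_succ, Finset.sum_range_succ]
        exact wnorm_add_le (Finset.sum_nonneg fun i _ => by positivity) (by positivity) ih (hpow k)
    refine hsum.trans (ENNReal.ofReal_le_ofReal ?_)
    have h3 : ∑ i ∈ Finset.range k, a ^ (i + 1) = a * ∑ i ∈ Finset.range k, a ^ i := by
      rw [Finset.mul_sum]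
      exact Finset.sum_congr rfl fun i _ => by ring
    rw [h3, mul_comm 2]
    refine mul_le_mul_of_nonneg_left ?_ ha
    refine (Summable.sum_le_tsum _ (fun i _ => by positivity)
      (summable_geometric_of_lt_one ha (by linarith))).trans ?_
    rw [tsum_geometric_of_lt_one ha (by linarith), inv_le_comm₀ (by linarith) two_pos]
    linarith
  · rw [add_sub_cancel, h1]
  · rw [add_sub_cancel, h2]

end BKernel

end Ring

/-! ### Holomorphy of sums, strips and regular phases -/

section Analysis

/-- A series of holomorphic functions with bounded sums of absolute values is holomorphic. -/
theorem differentiableOn_tsum_of_sum_norm_le {ι : Type*} {f : ι → ℂ → ℂ} {U : Set ℂ}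
    (hU : IsOpen U) {C : ℝ} (hf : ∀ i, DifferentiableOn ℂ (f i) U)
    (hC : ∀ z ∈ U, ∀ s : Finset ι, ∑ i ∈ s, ‖f i z‖ ≤ C) :
    DifferentiableOn ℂ (fun z => ∑' i, f i z) U := by
  intro z hz
  obtain ⟨r, hr, hrU⟩ := Metric.nhds_basis_closedBall.mem_iff.1 (hU.mem_nhds hz)
  have habs : |r| = r := abs_of_pos hr
  have hint : ∀ i, CircleIntegrable (fun x => ‖f i x‖) z r := fun i =>
    ContinuousOn.circleIntegrable' (((hf i).continuousOn.mono
      ((Metric.sphere_subset_closedBall).trans (habs.symm ▸ hrU))).norm)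
  -- The hypothesis bounds sums at each point, not sums of suprema. Averaging over a circle commutes
  -- with finite sums, so twice the circle averages of `‖f i‖` are a summable majorant on the
  -- half-radius disc.
  have hu : Summable fun i => 2 * Real.circleAverage (fun x => ‖f i x‖) z r := by
    refine Summable.mul_left 2 (summable_of_sum_le (c := C) (fun i => ?_) fun s => ?_)
    · exact Real.circleAverage_nonneg_of_nonneg fun x _ => norm_nonneg _
    · rw [← Real.circleAverage_fun_sum fun i _ => hint i]
      refine Real.circleAverage_mono_on_of_le_circle ?_ fun x hx => ?_
      · exact CircleIntegrable.fun_sum s fun i _ => hint i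
      · exact hC x (hrU (Metric.sphere_subset_closedBall (habs ▸ hx))) s
  have hloc : DifferentiableOn ℂ (fun w => ∑' i, f i w) (Metric.ball z (r / 2)) := by
    refine Complex.differentiableOn_tsum_of_summable_norm hu (fun i => (hf i).mono ?_)
      Metric.isOpen_ball fun i w hw => ?_
    · exact (Metric.ball_subset_closedBall.trans
        (Metric.closedBall_subset_closedBall (by linarith))).trans hrU
    · have hd : DiffContOnCl ℂ (f i) (Metric.ball z |r|) := by
        rw [habs]
        exact ((hf i).mono hrU).diffContOnCl_ball subset_rfl
      have hw' : w ∈ Metric.ball z |r| := by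
        rw [habs]
        exact Metric.ball_subset_ball (by linarith) hw
      -- On the half-radius disc the Cauchy kernel is at most `r / (r/2) = 2`.
      have hsph : ∀ θ : ℝ, ‖(circleMap z r θ - z) / (circleMap z r θ - w)‖ ≤ 2 := by
        intro θ
        have h1 : ‖circleMap z r θ - z‖ = r := by
          simp [habs]
        have h2 : r / 2 ≤ ‖circleMap z r θ - w‖ := by
          have h3 : ‖w - z‖ < r / 2 := by simpa [dist_eq_norm] using hw
          have h4 := norm_sub_norm_le (circleMap z r θ - z) (w - z)
          rw [sub_sub_sub_cancel_right] at h4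
          linarith
        rw [norm_div, h1, div_le_iff₀ (by linarith)]
        linarith
      rw [← hd.circleAverage_smul_div hw', ← smul_eq_mul (a := (2 : ℝ)),
        ← Real.circleAverage_fun_smul, Real.circleAverage, Real.circleAverage, norm_smul,
        smul_eq_mul, Real.norm_of_nonneg (by positivity)]
      refine mul_le_mul_of_nonneg_left ?_ (by positivity)
      refine intervalIntegral.norm_integral_le_of_norm_le Real.two_pi_pos.le
        (Eventually.of_forall fun θ _ => ?_) ((hint i).const_smul (a := (2 : ℝ)) )
      rw [norm_smul, smul_eq_mul]
      exact mul_le_mul_of_nonneg_right (hsph θ) (norm_nonneg _)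
  exact (hloc z (Metric.mem_ball_self (half_pos hr))).differentiableAt
    (Metric.ball_mem_nhds z (half_pos hr)) |>.differentiableWithinAt

lemma isOpen_strip (R : ℝ) : IsOpen (strip R) :=
  isOpen_lt (Complex.continuous_im.abs) continuous_const

lemma strip_mono {r R : ℝ} (h : r ≤ R) : strip r ⊆ strip R := fun _ hz => lt_of_lt_of_le hz h

lemma sub_ofReal_mem_strip_iff {R : ℝ} {z : ℂ} (a : ℝ) : z - (a : ℂ) ∈ strip R ↔ z ∈ strip R := by
  simp [strip]

lemma add_one_mem_strip_iff {R : ℝ} {z : ℂ} : z + 1 ∈ strip R ↔ z ∈ strip R := by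
  simp [strip]

lemma conj_mem_strip_iff {R : ℝ} {z : ℂ} : conj z ∈ strip R ↔ z ∈ strip R := by
  simp [strip]

lemma differentiableOn_comp_sub {R : ℝ} {f : ℂ → ℂ} (hf : DifferentiableOn ℂ f (strip R)) (a : ℝ) :
    DifferentiableOn ℂ (fun z => f (z - (a : ℂ))) (strip R) :=
  hf.comp (by fun_prop) fun _ hz => (sub_ofReal_mem_strip_iff a).2 hz

variable {d : ℕ} {ω : Fin d → ℝ}

lemma BKernel.sum_norm_le_norm (A : BKernel ω) (z : ℂ) (s : Finset (Fin d → ℤ)) :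
    ∑ n ∈ s, ‖A z n‖ ≤ ‖A‖ := by
  rw [BKernel.norm_def, ← ENNReal.ofReal_le_iff_le_toReal A.finite.ne,
    ENNReal.ofReal_sum_of_nonneg fun _ _ => norm_nonneg _]
  simp only [ofReal_norm]
  refine (ENNReal.sum_le_tsum s).trans ?_
  simpa using row_le_wnorm 1 A.1 z

/-- The closed subring of the bounded kernels that are holomorphic of period one on a strip. -/
def holSubring (ω : Fin d → ℝ) (ρ : ℝ) : Subring (BKernel ω) where
  carrier := {A | ∀ n, DifferentiableOn ℂ (fun z => A z n) (strip ρ) ∧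
    ∀ z ∈ strip ρ, A (z + 1) n = A z n}
  mul_mem' {A B} hA hB n := by
    refine ⟨?_, fun z hz => ?_⟩
    · obtain ⟨K, hK⟩ := B.exists_bound
      refine differentiableOn_tsum_of_sum_norm_le (C := ‖A‖ * K) (isOpen_strip ρ)
        (fun l => (hA l).1.mul (differentiableOn_comp_sub (hB (n - l)).1 _)) fun z _ s => ?_
      calc ∑ l ∈ s, ‖A z l * B (z - (dot l ω : ℂ)) (n - l)‖ ≤ ∑ l ∈ s, ‖A z l‖ * K := by
            refine Finset.sum_le_sum fun l _ => ?_
            rw [norm_mul]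
            gcongr
            exact hK _ _
        _ = (∑ l ∈ s, ‖A z l‖) * K := by rw [Finset.sum_mul]
        _ ≤ ‖A‖ * K := by
            gcongr
            · exact (norm_nonneg _).trans (hK 0 0)
            · exact A.sum_norm_le_norm z s
    · refine tsum_congr fun l => ?_
      rw [(hA l).2 z hz, ← (hB (n - l)).2 _ ((sub_ofReal_mem_strip_iff _).2 hz)]
      congr 2
      ring
  one_mem' n := by
    refine ⟨?_, fun z _ => rfl⟩
    change DifferentiableOn ℂ (fun z => if n = 0 then (1 : ℂ) else 0) _
    fun_prop
  add_mem' {A B} hA hB n := ⟨(hA n).1.add (hB n).1,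
    fun z hz => congrArg₂ (· + ·) ((hA n).2 z hz) ((hB n).2 z hz)⟩
  zero_mem' n := ⟨differentiableOn_const (0 : ℂ), fun z _ => rfl⟩
  neg_mem' {A} hA n := ⟨(hA n).1.neg, fun z hz => congrArg (- ·) ((hA n).2 z hz)⟩

lemma holSubring_anti {r ρ : ℝ} (h : r ≤ ρ) : holSubring ω ρ ≤ holSubring ω r := fun _ hA n =>
  ⟨(hA n).1.mono (strip_mono h), fun z hz => (hA n).2 z (strip_mono h hz)⟩

/-- Norm convergence is uniform in `z` for each entry, so a limit of holomorphic entries is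
holomorphic. -/
lemma isClosed_holSubring (ρ : ℝ) : IsClosed (holSubring ω ρ : Set (BKernel ω)) := by
  refine isClosed_of_closure_subset fun A hA => ?_
  obtain ⟨u, hu, hlim⟩ := mem_closure_iff_seq_limit.1 hA
  intro n
  refine ⟨?_, fun z hz => ?_⟩
  · have : TendstoUniformlyOn (fun k z => u k z n) (fun z => A z n) atTop (strip ρ) := by
      rw [Metric.tendstoUniformlyOn_iff]
      intro ε hε
      filter_upwards [Metric.tendsto_atTop'.1 hlim ε hε |>.elim fun N hN =>
        eventually_gt_atTop N |>.mono fun k hk => hN k hk] with k hk z _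
      rw [dist_comm, dist_eq_norm]
      rw [dist_eq_norm] at hk
      exact lt_of_le_of_lt (by simpa using BKernel.entry_le_norm (u k - A) z n) hk
    exact this.tendstoLocallyUniformlyOn.differentiableOn
      (Eventually.of_forall fun k => (hu k n).1) (isOpen_strip ρ)
  · refine tendsto_nhds_unique (BKernel.tendsto_entry hlim (z + 1) n) ?_
    simpa only [(hu _ n).2 z hz] using BKernel.tendsto_entry hlim z n

lemma regularPhases_subset (R : ℝ) (V : ℂ → ℂ) : regularPhases ω R V ⊆ strip R := fun _ hz => hz.1

lemma regularPhases_sub {R : ℝ} {V : ℂ → ℂ} {z : ℂ} (hz : z ∈ regularPhases ω R V)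
    (l : Fin d → ℤ) : z - (dot l ω : ℂ) ∈ regularPhases ω R V := by
  refine ⟨(sub_ofReal_mem_strip_iff _).2 hz.1, fun n => ?_⟩
  have := hz.2 (l + n)
  rw [dot_add, Complex.ofReal_add, ← sub_sub] at this
  exact this

lemma regularPhases_mono {r R : ℝ} (h : r ≤ R) (V : ℂ → ℂ) :
    regularPhases ω r V ⊆ regularPhases ω R V := fun _ hz => ⟨strip_mono h hz.1, hz.2⟩

/-- A meromorphic function has countably many poles, and so do its countably many translates; the
complement of a countable set is dense. -/
lemma strip_subset_closure_regularPhases {R : ℝ} {V : ℂ → ℂ} (hV : MeromorphicOn V (strip R)) :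
    strip R ⊆ closure (regularPhases ω R V) := by
  have hcount : (⋃ n : Fin d → ℤ,
      (fun z : ℂ => z - (dot n ω : ℂ)) ⁻¹' ({z | AnalyticAt ℂ V z}ᶜ ∩ strip R)).Countable := by
    refine Set.countable_iUnion fun n => ?_
    exact hV.countable_compl_analyticAt_inter.preimage (sub_left_injective)
  have hdense := (hcount.dense_compl ℝ).open_subset_closure_inter (isOpen_strip R)
  refine hdense.trans (closure_mono ?_)
  rintro z ⟨hz, hz'⟩
  refine ⟨hz, fun n => ?_⟩
  by_contra hn
  exact hz' (Set.mem_iUnion.2 ⟨n, hn, (sub_ofReal_mem_strip_iff _).2 hz⟩)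

lemma eqOn_strip_of_eqOn_regularPhases {R : ℝ} {V : ℂ → ℂ} (hV : MeromorphicOn V (strip R))
    {f g : ℂ → ℂ} (hf : ContinuousOn f (strip R)) (hg : ContinuousOn g (strip R))
    (h : Set.EqOn f g (regularPhases ω R V)) : Set.EqOn f g (strip R) :=
  h.of_subset_closure hf hg (regularPhases_subset R V) (strip_subset_closure_regularPhases hV)

/-- The Cauchy estimate for real shifts of a bounded holomorphic function on a strip. -/
lemma norm_sub_shift_le {r ρ C : ℝ} (hr : r < ρ) {f : ℂ → ℂ}
    (hf : DifferentiableOn ℂ f (strip ρ)) (hper : ∀ z ∈ strip ρ, f (z + 1) = f z)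
    (hC : ∀ z ∈ strip ρ, ‖f z‖ ≤ C) {z : ℂ} (hz : z ∈ strip r) (a : ℝ) :
    ‖f z - f (z - a)‖ ≤ C / (ρ - r) * torusNorm a := by
  have hper' : ∀ (m : ℤ) (z : ℂ), z ∈ strip ρ → f (z + m) = f z := by
    intro m
    induction m using Int.induction_on with
    | zero => simp
    | succ i ih =>
      intro z hz
      have h1 : z + (i : ℤ) ∈ strip ρ := by simpa [strip] using hz
      have := hper _ h1
      rw [ih z hz] at this
      rw [← this]
      push_cast
      ring_nf
    | pred i ih =>
      intro z hz
      have h1 : z + ((-(i : ℤ) - 1 : ℤ) : ℂ) ∈ strip ρ := by simpa [strip] using hz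
      rw [← hper _ h1, ← ih z hz]
      push_cast
      ring_nf
  have hsub : ∀ {w : ℂ}, w ∈ strip r → ∀ {x : ℂ}, ‖x - w‖ < ρ - r → x ∈ strip ρ := by
    intro w hw x hx
    have h1 := (Complex.abs_im_le_norm (x - w)).trans_lt hx
    have h2 : |w.im| < r := hw
    rw [Complex.sub_im] at h1
    have h3 := abs_sub_abs_le_abs_sub x.im w.im
    change |x.im| < ρ
    linarith
  have hderiv : ∀ w ∈ strip r, ‖deriv f w‖ ≤ C / (ρ - r) := by
    intro w hw
    have hC0 : 0 ≤ C := (norm_nonneg _).trans (hC w (strip_mono hr.le hw))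
    have h1 : ∀ t, 0 < t → t < ρ - r → ‖deriv f w‖ ≤ C / t := by
      intro t ht htr
      refine Complex.norm_deriv_le_of_forall_mem_sphere_norm_le ht ?_ fun x hx => hC x ?_
      · refine (hf.mono fun x hx => ?_).diffContOnCl_ball (U := Metric.closedBall w t) subset_rfl
        exact hsub hw ((by simpa [dist_eq_norm] using hx : ‖x - w‖ ≤ t).trans_lt htr)
      · exact hsub hw ((by simpa [dist_eq_norm] using hx : ‖x - w‖ = t).trans_lt htr)
    have h2 : Tendsto (fun t => C / t) (𝓝[<] (ρ - r)) (𝓝 (C / (ρ - r))) :=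
      (tendsto_const_nhds.div tendsto_id (sub_pos.2 hr).ne').mono_left
        nhdsWithin_le_nhds
    refine ge_of_tendsto h2 ?_
    filter_upwards [Ioo_mem_nhdsLT (sub_pos.2 hr)] with t ht
    exact h1 t ht.1 ht.2
  have hlip : ∀ b : ℝ, ‖f z - f (z - b)‖ ≤ C / (ρ - r) * |b| := by
    intro b
    have hconv : Convex ℝ (strip r) := by
      have : strip r = Complex.imLm ⁻¹' (Set.Ioo (-r) r) := by
        ext x; simp [strip, abs_lt]
      rw [this]
      exact (convex_Ioo _ _).linear_preimage _
    have := hconv.norm_image_sub_le_of_norm_deriv_le (𝕜 := ℂ) (f := f)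
      (fun x hx => hf.differentiableAt ((isOpen_strip ρ).mem_nhds (strip_mono hr.le hx)))
      hderiv ((sub_ofReal_mem_strip_iff b).2 hz) hz
    simpa using this
  -- Periodicity allows `a` to be replaced by its difference from the nearest integer.
  have h1 := hlip (a - round a)
  have h2 : z - ((a - round a : ℝ) : ℂ) = z - a + (round a : ℤ) := by push_cast; ring
  rw [h2, hper' _ _ ((sub_ofReal_mem_strip_iff a).2 (strip_mono hr.le hz))] at h1
  rwa [torusNorm, UnitAddCircle.norm_eq]

end Analysis

/-! ### Division by the differences of the potential -/

section Division

variable {d : ℕ} {ω : Fin d → ℝ}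

lemma analyticAt_add_one {R : ℝ} {V : ℂ → ℂ} (hper : ∀ z ∈ strip R, V (z + 1) = V z) {z : ℂ}
    (hz : z ∈ strip R) (h : AnalyticAt ℂ V z) : AnalyticAt ℂ V (z + 1) := by
  have h1 : AnalyticAt ℂ (fun w => V (w - 1)) (z + 1) :=
    AnalyticAt.fun_comp (by simpa using h) (by fun_prop)
  refine h1.congr ?_
  filter_upwards [(isOpen_strip R).mem_nhds (add_one_mem_strip_iff.2 hz)] with w hw
  have := hper (w - 1) (by simpa using (sub_ofReal_mem_strip_iff (1 : ℝ)).2 hw)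
  rw [← this, sub_add_cancel]

lemma eventually_analyticAt_sub {V : ℂ → ℂ} {z : ℂ} {a : ℂ} (h : MeromorphicAt V (z - a)) :
    ∀ᶠ x in 𝓝[≠] z, AnalyticAt ℂ V (x - a) := by
  have : Tendsto (fun x : ℂ => x - a) (𝓝[≠] z) (𝓝[≠] (z - a)) := by
    refine tendsto_nhdsWithin_iff.2 ⟨?_, ?_⟩
    · exact (Continuous.tendsto (by fun_prop) z).mono_left nhdsWithin_le_nhds
    · filter_upwards [self_mem_nhdsWithin] with x hx
      exact fun h => hx (sub_left_injective h)
  exact this.eventually h.eventually_analyticAt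

/-- The reciprocal of a difference `g(z) - g(z - a)` that is bounded away from zero off the poles
extends holomorphically through the poles. -/
lemma exists_holomorphic_reciprocal {R : ℝ} {V f : ℂ → ℂ} (hV : MeromorphicOn V (strip R))
    (hper : ∀ z ∈ strip R, V (z + 1) = V z) (hf : DifferentiableOn ℂ f (strip R))
    (hfper : ∀ z ∈ strip R, f (z + 1) = f z) (n : Fin d → ℤ) {c : ℝ} (hc : 0 < c)
    (hsep : ∀ z ∈ strip R, AnalyticAt ℂ V z → AnalyticAt ℂ V (z - (dot n ω : ℂ)) →
      c ≤ ‖V z + f z - (V (z - (dot n ω : ℂ)) + f (z - (dot n ω : ℂ)))‖) :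
    ∃ G : ℂ → ℂ, DifferentiableOn ℂ G (strip R) ∧ (∀ z ∈ strip R, G (z + 1) = G z) ∧
      (∀ z ∈ strip R, ‖G z‖ ≤ 1 / c) ∧
      ∀ z ∈ strip R, AnalyticAt ℂ V z → AnalyticAt ℂ V (z - (dot n ω : ℂ)) →
        G z * (V z + f z - (V (z - (dot n ω : ℂ)) + f (z - (dot n ω : ℂ)))) = 1 := by
  set a : ℂ := (dot n ω : ℂ) with ha
  set g : ℂ → ℂ := fun z => V z + f z - (V (z - a) + f (z - a)) with hg
  have hmem : ∀ {z}, z ∈ strip R → z - a ∈ strip R := fun hz => (sub_ofReal_mem_strip_iff _).2 hz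
  have hfa : ∀ z ∈ strip R, AnalyticAt ℂ f z := fun z hz =>
    hf.analyticAt ((isOpen_strip R).mem_nhds hz)
  have hfa' : ∀ z ∈ strip R, AnalyticAt ℂ (fun z => f (z - a)) z := fun z hz =>
    AnalyticAt.fun_comp (hfa _ (hmem hz)) (by fun_prop)
  have hga : ∀ z ∈ strip R, AnalyticAt ℂ V z → AnalyticAt ℂ V (z - a) → AnalyticAt ℂ g z := by
    intro z hz h1 h2
    have h3 : AnalyticAt ℂ (fun z => V (z - a)) z := AnalyticAt.fun_comp h2 (by fun_prop)
    exact (h1.add (hfa z hz)).sub (h3.add (hfa' z hz))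
  have hgm : MeromorphicOn g⁻¹ (strip R) := by
    intro z hz
    refine MeromorphicAt.inv ?_
    refine ((hV z hz).add (hfa z hz).meromorphicAt).sub
      (MeromorphicAt.add ?_ (hfa' z hz).meromorphicAt)
    exact meromorphicAt_comp_sub_const_iff_meromorphicAt.2 (hV _ (hmem hz))
  set G := toMeromorphicNFOn g⁻¹ (strip R) with hG
  have hreg : ∀ z ∈ strip R, AnalyticAt ℂ V z → AnalyticAt ℂ V (z - a) → G z = (g z)⁻¹ := by
    intro z hz h1 h2
    have h3 : AnalyticAt ℂ g⁻¹ z := (hga z hz h1 h2).inv (by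
      rw [← norm_pos_iff]; exact hc.trans_le (hsep z hz h1 h2))
    rw [hG, toMeromorphicNFOn_eq_toMeromorphicNFAt hgm hz,
      toMeromorphicNFAt_eq_self.2 h3.meromorphicNFAt, Pi.inv_apply]
  have hev : ∀ z ∈ strip R, ∀ᶠ x in 𝓝[≠] z, ‖g⁻¹ x‖ ≤ 1 / c := by
    intro z hz
    filter_upwards [(hV z hz).eventually_analyticAt, eventually_analyticAt_sub (hV _ (hmem hz)),
      nhdsWithin_le_nhds ((isOpen_strip R).mem_nhds hz)] with x h1 h2 h3
    rw [Pi.inv_apply, norm_inv, one_div]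
    exact inv_anti₀ hc (hsep x h3 h1 h2)
  have hGa : ∀ z ∈ strip R, AnalyticAt ℂ G z := by
    intro z hz
    -- A pole of the reciprocal would force its norm to infinity, against the bound `1 / c` on a
    -- punctured neighbourhood.
    have h1 : 0 ≤ meromorphicOrderAt g⁻¹ z := by
      by_contra! hneg
      have h2 := tendsto_norm_cobounded_atTop.comp (tendsto_cobounded_of_meromorphicOrderAt_neg hneg)
      obtain ⟨x, hx, hx'⟩ := ((h2.eventually_gt_atTop (1 / c)).and (hev z hz)).exists
      exact absurd hx' (not_le.2 hx)
    have h2 := (hgm z hz).meromorphicOrderAt_nonneg_iff_analyticAt_toMeromorphicNFAt.1 h1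
    exact h2.congr (toMeromorphicNFOn_eq_toMeromorphicNFAt_on_nhds hgm hz).symm
  have hGd : DifferentiableOn ℂ G (strip R) := fun z hz =>
    (hGa z hz).differentiableAt.differentiableWithinAt
  refine ⟨G, hGd, ?_, ?_, ?_⟩
  · refine eqOn_strip_of_eqOn_regularPhases (ω := ω) hV (f := fun z => G (z + 1)) ?_ hGd.continuousOn
      fun z hz => ?_
    · exact hGd.continuousOn.comp (by fun_prop) fun z hz => add_one_mem_strip_iff.2 hz
    have h1 : AnalyticAt ℂ V z := by simpa using hz.2 0
    have h2 := hz.2 n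
    have h3 : z + 1 - a = z - a + 1 := by ring
    change G (z + 1) = G z
    rw [hreg z hz.1 h1 h2, hreg (z + 1) (add_one_mem_strip_iff.2 hz.1)
      (analyticAt_add_one hper hz.1 h1)
      (by rw [h3]; exact analyticAt_add_one hper (hmem hz.1) h2)]
    simp only [hg]
    rw [h3, hper z hz.1, hfper z hz.1, hper _ (hmem hz.1), hfper _ (hmem hz.1)]
  · intro z hz
    have h1 : Tendsto (fun x => ‖G x‖) (𝓝[≠] z) (𝓝 ‖G z‖) :=
      ((hGa z hz).continuousAt.norm.tendsto).mono_left nhdsWithin_le_nhds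
    refine le_of_tendsto h1 ?_
    filter_upwards [hev z hz, hgm.toMeromorphicNFOn_eq_self_on_nhdsNE hz] with x h2 h3
    rwa [hG, h3]
  · intro z hz h1 h2
    rw [hreg z hz h1 h2]
    exact inv_mul_cancel₀ (norm_pos_iff.1 (hc.trans_le (hsep z hz h1 h2)))

end Division

/-! ### Truncation, and commutators with the potential -/

section Restrict

variable {d : ℕ} {ω : Fin d → ℝ}

namespace BKernel

open Classical in
/-- The restriction of a kernel to the `n` in a set. -/
noncomputable def restrict (s : Set (Fin d → ℤ)) (A : BKernel ω) : BKernel ω :=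
  ⟨fun z n => if n ∈ s then A z n else 0, (wnorm_mono fun z n => by
    split_ifs <;> simp).trans_lt A.finite⟩

lemma restrict_of_mem {s : Set (Fin d → ℤ)} {n : Fin d → ℤ} (hn : n ∈ s) (A : BKernel ω) (z : ℂ) :
    restrict s A z n = A z n := if_pos hn

lemma restrict_of_notMem {s : Set (Fin d → ℤ)} {n : Fin d → ℤ} (hn : n ∉ s) (A : BKernel ω)
    (z : ℂ) : restrict s A z n = 0 := if_neg hn

lemma wnorm_restrict_le (w : (Fin d → ℤ) → ℝ≥0∞) (s : Set (Fin d → ℤ)) (A : BKernel ω) :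
    wnorm w (restrict s A).1 ≤ wnorm w A.1 := wnorm_mono fun z n => by
  by_cases hn : n ∈ s
  · rw [restrict_of_mem hn]
  · rw [restrict_of_notMem hn]; simp

lemma wnorm_restrict_le_mul {w w' : (Fin d → ℤ) → ℝ≥0∞} {s : Set (Fin d → ℤ)} {c : ℝ≥0∞}
    (h : ∀ n ∈ s, w' n ≤ c * w n) (A : BKernel ω) :
    wnorm w' (restrict s A).1 ≤ c * wnorm w A.1 := wnorm_le_mul_wnorm fun z n => by
  by_cases hn : n ∈ s
  · rw [restrict_of_mem hn, mul_left_comm]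
    gcongr
    exact h n hn
  · rw [restrict_of_notMem hn]; simp

lemma restrict_mem_holSubring {ρ : ℝ} {A : BKernel ω} (hA : A ∈ holSubring ω ρ)
    (s : Set (Fin d → ℤ)) : restrict s A ∈ holSubring ω ρ := by
  intro n
  by_cases hn : n ∈ s
  · simpa only [restrict_of_mem hn] using hA n
  · simp only [restrict_of_notMem hn]
    exact ⟨differentiableOn_const _, fun _ _ => trivial⟩

end BKernel

/-- `[A, V] = D` at the phases in `S`. -/
def HasCommutator (V : ℂ → ℂ) (S : Set ℂ) (A D : BKernel ω) : Prop :=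
  ∀ z ∈ S, ∀ n, A z n * (V (z - (dot n ω : ℂ)) - V z) = D z n

namespace HasCommutator

variable {V : ℂ → ℂ} {S : Set ℂ} {A B D E : BKernel ω}

lemma mono {T : Set ℂ} (h : HasCommutator V S A D) (hT : T ⊆ S) : HasCommutator V T A D :=
  fun z hz => h z (hT hz)

lemma add (hA : HasCommutator V S A D) (hB : HasCommutator V S B E) :
    HasCommutator V S (A + B) (D + E) := fun z hz n => by
  simp only [BKernel.coe_add, Pi.add_apply, add_mul, hA z hz n, hB z hz n]

lemma one : HasCommutator V S (1 : BKernel ω) 0 := fun z _ n => by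
  by_cases hn : n = 0
  · subst hn; simp
  · simp [unit, diag, hn]

/-- The Leibniz rule `[AB, V] = A[B, V] + [A, V]B`. It holds term by term, since `V` at the
intermediate phase `z - l·ω` cancels; the second factor is evaluated there, so `S` must be invariant
under the shifts. -/
lemma mul (hS : ∀ z ∈ S, ∀ l : Fin d → ℤ, z - (dot l ω : ℂ) ∈ S)
    (hA : HasCommutator V S A D) (hB : HasCommutator V S B E) :
    HasCommutator V S (A * B) (A * E + D * B) := fun z hz n => by
  refine ((A.hasSum_mul B z n).mul_right _).unique ?_
  refine HasSum.congr_fun ((A.hasSum_mul E z n).add (D.hasSum_mul B z n)) fun l => ?_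
  rw [← hA z hz l, ← hB _ (hS z hz l) (n - l)]
  have : z - (dot l ω : ℂ) - (dot (n - l) ω : ℂ) = z - (dot n ω : ℂ) := by
    rw [dot_sub]; push_cast; ring
  rw [this]
  ring

lemma of_tendsto {u v : ℕ → BKernel ω} (h : ∀ k, HasCommutator V S (u k) (v k))
    (hu : Tendsto u atTop (𝓝 A)) (hv : Tendsto v atTop (𝓝 D)) : HasCommutator V S A D :=
  fun z hz n => tendsto_nhds_unique ((BKernel.tendsto_entry hu z n).mul_const _)
    ((BKernel.tendsto_entry hv z n).congr fun k => (h k z hz n).symm)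

end HasCommutator

end Restrict

/-! ### The homological equation and one conjugation -/

section Step

variable {d : ℕ} {ω : Fin d → ℝ}

namespace BKernel

/-- The diagonal kernels. -/
def IsDiagonal (f : BKernel ω) : Prop := ∀ z n, n ≠ 0 → f z n = 0

lemma IsDiagonal.val_eq {f : BKernel ω} (hf : f.IsDiagonal) : f.1 = diag d (fun z => f z 0) := by
  funext z n
  by_cases hn : n = 0
  · subst hn; simp [diag]
  · simp [diag, hn, hf z n hn]

lemma IsDiagonal.mul_apply {f : BKernel ω} (hf : f.IsDiagonal) (A : BKernel ω) (z : ℂ)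
    (n : Fin d → ℤ) : (f * A) z n = f z 0 * A z n := by
  rw [coe_mul, hf.val_eq, kmul_diag_left]
  simp [diag]

lemma IsDiagonal.apply_mul {f : BKernel ω} (hf : f.IsDiagonal) (A : BKernel ω) (z : ℂ)
    (n : Fin d → ℤ) : (A * f) z n = A z n * f (z - (dot n ω : ℂ)) 0 := by
  rw [coe_mul, hf.val_eq, kmul_diag_right]
  simp [diag]

lemma isDiagonal_restrict_zero (A : BKernel ω) : (restrict {0} A).IsDiagonal :=
  fun z _ hn => restrict_of_notMem (by simpa using hn) A z

lemma IsDiagonal.add {f g : BKernel ω} (hf : f.IsDiagonal) (hg : g.IsDiagonal) :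
    (f + g).IsDiagonal := fun z n hn => by
  simp [hf z n hn, hg z n hn]

end BKernel

open BKernel

/-- Solution of the homological equation for the potential `V + f`. -/
lemma exists_homological_solution {V : ℂ → ℂ} {ρ' N c : ℝ} {f M : BKernel ω}
    (hV : MeromorphicOn V (strip ρ')) (hper : ∀ z ∈ strip ρ', V (z + 1) = V z)
    (hf : f ∈ holSubring ω ρ') (hM : M ∈ holSubring ω ρ') (hc : 0 < c)
    (hsep : ∀ n : Fin d → ℤ, n ≠ 0 → bracket n ≤ N → ∀ z ∈ strip ρ', AnalyticAt ℂ V z →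
      AnalyticAt ℂ V (z - (dot n ω : ℂ)) →
      c ≤ ‖V z + f z 0 - (V (z - (dot n ω : ℂ)) + f (z - (dot n ω : ℂ)) 0)‖) :
    ∃ W : BKernel ω, W ∈ holSubring ω ρ' ∧
      (∀ w : (Fin d → ℤ) → ℝ≥0∞, wnorm w W.1 ≤ ENNReal.ofReal (1 / c) * wnorm w M.1) ∧
      ∀ z ∈ regularPhases ω ρ' V, ∀ n,
        W z n * (V (z - (dot n ω : ℂ)) + f (z - (dot n ω : ℂ)) 0 - (V z + f z 0)) =
          -restrict {n | n ≠ 0 ∧ bracket n ≤ N} M z n := by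
  classical
  set s : Set (Fin d → ℤ) := {n | n ≠ 0 ∧ bracket n ≤ N} with hs
  have hex := fun (n : Fin d → ℤ) (hn : n ∈ s) =>
    exists_holomorphic_reciprocal (ω := ω) hV hper (hf 0).1 (hf 0).2 n hc (hsep n hn.1 hn.2)
  choose! G hGd hGper hGb hGeq using hex
  -- The norm is a supremum over all of `ℂ`, while `G` is controlled only on the strip; hence the
  -- extension by zero. Real shifts preserve the strip.
  set W₀ : Kernel d := fun z n => if n ∈ s ∧ z ∈ strip ρ' then G n z * M z n else 0 with hW₀
  have hbound : ∀ (w : (Fin d → ℤ) → ℝ≥0∞) (z : ℂ) (n : Fin d → ℤ), ‖W₀ z n‖ₑ * w n ≤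
      ENNReal.ofReal (1 / c) * (‖M z n‖ₑ * w n) := by
    intro w z n
    simp only [hW₀]
    split_ifs with h
    · rw [enorm_mul, mul_assoc]
      gcongr
      rw [← ofReal_norm]
      exact ENNReal.ofReal_le_ofReal (hGb n h.1 z h.2)
    · simp
  have hle : ∀ w : (Fin d → ℤ) → ℝ≥0∞, wnorm w W₀ ≤ ENNReal.ofReal (1 / c) * wnorm w M.1 :=
    fun w => wnorm_le_mul_wnorm (hbound w)
  refine ⟨⟨W₀, (hle 1).trans_lt (ENNReal.mul_lt_top ENNReal.ofReal_lt_top M.2)⟩, ?_, hle, ?_⟩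
  · intro n
    by_cases hn : n ∈ s
    · constructor
      · refine ((hGd n hn).mul (hM n).1).congr fun z hz => ?_
        exact if_pos ⟨hn, hz⟩
      · intro z hz
        change W₀ (z + 1) n = W₀ z n
        simp only [hW₀, if_pos (show n ∈ s ∧ z ∈ strip ρ' from ⟨hn, hz⟩),
          if_pos (show n ∈ s ∧ z + 1 ∈ strip ρ' from ⟨hn, add_one_mem_strip_iff.2 hz⟩),
          hGper n hn z hz, (hM n).2 z hz]
    · have : ∀ z, W₀ z n = 0 := fun z => if_neg fun h => hn h.1
      simp only [this]
      exact ⟨differentiableOn_const _, fun _ _ => trivial⟩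
  · intro z hz n
    change W₀ z n * _ = _
    by_cases hn : n ∈ s
    · rw [restrict_of_mem hn]
      simp only [hW₀, if_pos (show n ∈ s ∧ z ∈ strip ρ' from ⟨hn, hz.1⟩)]
      linear_combination (-M z n) * hGeq n hn z hz.1 (by simpa using hz.2 0) (hz.2 n)
    · rw [restrict_of_notMem hn]
      simp only [hW₀, if_neg (show ¬(n ∈ s ∧ z ∈ strip ρ') from fun h => hn h.1)]
      simp

/-- One step of the iteration: a conjugation by `1 + W` that makes the perturbation smaller. -/
lemma exists_conjugation_step {w w' : (Fin d → ℤ) → ℝ≥0∞} (hw : IsWeight w)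
    (hwt : ∀ n, w n ≠ ⊤) (hw' : ∀ n, w' n ≤ w n) {V : ℂ → ℂ} {ρ ρ' N c e q : ℝ}
    {P f M M₀ : BKernel ω} (hρ : ρ' ≤ ρ)
    (hV : MeromorphicOn V (strip ρ')) (hper : ∀ z ∈ strip ρ', V (z + 1) = V z)
    (hf : f ∈ holSubring ω ρ) (hfd : f.IsDiagonal) (hM : M ∈ holSubring ω ρ) (hc : 0 < c)
    (hsep : ∀ n : Fin d → ℤ, n ≠ 0 → bracket n ≤ N → ∀ z ∈ strip ρ', AnalyticAt ℂ V z →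
      AnalyticAt ℂ V (z - (dot n ω : ℂ)) →
      c ≤ ‖V z + f z 0 - (V (z - (dot n ω : ℂ)) + f (z - (dot n ω : ℂ)) 0)‖)
    (he : 0 ≤ e) (hMe : wnorm w M.1 ≤ ENNReal.ofReal e) (hec : e / c ≤ 1 / 4) (hq : 0 ≤ q)
    (hN : 1 ≤ N)
    (hcut : ∀ n, N < bracket n → w' n ≤ ENNReal.ofReal q * w n)
    (hcomm : HasCommutator V (regularPhases ω ρ' V) P (f * P + M * P - P * M₀)) :
    ∃ W M' : BKernel ω, W ∈ holSubring ω ρ' ∧ M' ∈ holSubring ω ρ' ∧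
      wnorm w W.1 ≤ ENNReal.ofReal (e / c) ∧
      wnorm w' M'.1 ≤ ENNReal.ofReal (q * e + 6 * e * (e / c)) ∧
      HasCommutator V (regularPhases ω ρ' V) ((1 + W) * P)
        ((f + restrict {0} M) * ((1 + W) * P) + M' * ((1 + W) * P) - (1 + W) * P * M₀) := by
  have hf' := holSubring_anti hρ hf
  have hM' := holSubring_anti hρ hM
  obtain ⟨W, hW, hWn, hWeq⟩ := exists_homological_solution hV hper hf' hM' hc hsep
  set η := e / c with hη
  have hη0 : 0 ≤ η := div_nonneg he hc.le
  have hWw : wnorm w W.1 ≤ ENNReal.ofReal η := by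
    refine (hWn w).trans ((mul_le_mul_right hMe _).trans_eq ?_)
    rw [← ENNReal.ofReal_mul (by positivity), hη]
    ring_nf
  obtain ⟨Y, hYm, hYn, -, hYinv⟩ := exists_inverse_one_add hw hwt hη0 (by linarith) hWw
    (holSubring ω ρ') (isClosed_holSubring ρ') hW
  set L := restrict {n : Fin d → ℤ | n ≠ 0 ∧ bracket n ≤ N} M with hL
  set D := restrict ({0} : Set (Fin d → ℤ)) M with hD
  set H := restrict {n : Fin d → ℤ | N < bracket n} M with hH
  have hsum : M = L + D + H := by
    ext z n
    simp only [coe_add, Pi.add_apply]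
    by_cases hn : n = 0
    · subst hn
      have hb : bracket (0 : Fin d → ℤ) = 1 := by simp [bracket]
      rw [hL, hD, hH, restrict_of_notMem (by simp), restrict_of_mem (Set.mem_singleton _),
        restrict_of_notMem (by simp [hb, hN])]
      simp
    · by_cases hb : bracket n ≤ N
      · rw [hL, hD, hH, restrict_of_mem (Set.mem_ofPred.2 ⟨hn, hb⟩), restrict_of_notMem (by simpa using hn),
          restrict_of_notMem (by simpa using hb)]
        simp
      · rw [hL, hD, hH, restrict_of_notMem fun h => hb h.2, restrict_of_notMem (by simpa using hn),
          restrict_of_mem (by simpa using hb)]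
        simp
  have hHn : wnorm w H.1 ≤ ENNReal.ofReal e := (wnorm_restrict_le w _ M).trans hMe
  have hDn : wnorm w D.1 ≤ ENNReal.ofReal e := (wnorm_restrict_le w _ M).trans hMe
  have hHm : H ∈ holSubring ω ρ' := restrict_mem_holSubring hM' _
  have hDm : D ∈ holSubring ω ρ' := restrict_mem_holSubring hM' _
  -- With `[W, V] = fW - Wf - L` and `M = L + D + H`, one has `(1 + W)(V + f + M) = (V + f + D)(1 +
  -- W) + H + X`. The new remainder is `(H + X)(1 + W)⁻¹`.
  set X := W * M - D * W with hX
  have hXm : X ∈ holSubring ω ρ' := sub_mem (mul_mem hW hM') (mul_mem hDm hW)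
  have hXn : wnorm w X.1 ≤ ENNReal.ofReal (2 * (e * η)) := by
    refine (BKernel.wnorm_sub_le (by positivity) (by positivity) (wnorm_mul_le hw hη0 hWw hMe)
      (wnorm_mul_le hw he hDn hWw)).trans_eq ?_
    ring_nf
  refine ⟨W, (H + X) * (1 + Y), hW, mul_mem (add_mem hHm hXm) (add_mem (one_mem _) hYm), hWw, ?_, ?_⟩
  · have h1 : (H + X) * (1 + Y) = H + (H * Y + (X + X * Y)) := by noncomm_ring
    have h2 : wnorm w' H.1 ≤ ENNReal.ofReal (q * e) := by
      rw [ENNReal.ofReal_mul hq]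
      exact (wnorm_restrict_le_mul hcut M).trans (mul_le_mul_right hMe _)
    -- Only `H` itself needs the gain from the smaller weight. The other terms carry a factor `η`,
    -- and their sum is at most `4eη + 4eη² ≤ 6eη`.
    have h3 : wnorm w' (H * Y + (X + X * Y)).1 ≤ ENNReal.ofReal (6 * e * η) := by
      refine (wnorm_weight_mono hw' _).trans ?_
      refine (BKernel.wnorm_add_le (by positivity) (by positivity) (wnorm_mul_le hw he hHn hYn)
        (BKernel.wnorm_add_le (by positivity) (by positivity) hXn
          (wnorm_mul_le hw (by positivity) hXn hYn))).trans (ENNReal.ofReal_le_ofReal ?_)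
      have : e * η * η ≤ e * η * (1 / 4) := by gcongr
      nlinarith [mul_nonneg he hη0]
    rw [h1]
    exact BKernel.wnorm_add_le (by positivity) (by positivity) h2 h3
  · have hWc : HasCommutator V (regularPhases ω ρ' V) W (f * W - W * f - L) := by
      intro z hz n
      simp only [coe_sub, Pi.sub_apply, hfd.mul_apply, hfd.apply_mul]
      linear_combination hWeq z hz n
    have h1 := HasCommutator.mul (fun z hz l => regularPhases_sub hz l)
      (HasCommutator.one.add hWc) hcomm
    have h2 : (H + X) * (1 + Y) * ((1 + W) * P) = (H + X) * P := by
      rw [mul_assoc, ← mul_assoc (1 + Y), hYinv, one_mul]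
    rw [h2]
    convert h1 using 1
    rw [hX]
    have h3 : (W * M - D * W) * P = W * M * P - D * W * P := sub_mul _ _ _
    have h4 : M * P = (L + D + H) * P := congrArg (· * P) hsum
    have h5 : W * (f * P + M * P - P * M₀) = W * f * P + W * M * P - W * P * M₀ := by noncomm_ring
    rw [add_mul H, h3, add_mul 1 W (f * P + M * P - P * M₀), h5, h4]
    noncomm_ring

end Step

/-! ### Power weights and mixed weights -/

section Weights

variable {d : ℕ}

lemma one_le_bracket (n : Fin d → ℤ) : 1 ≤ bracket n := le_max_left _ _

lemma bracket_pos (n : Fin d → ℤ) : 0 < bracket n := one_pos.trans_le (one_le_bracket n)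

lemma bracket_add_le (n m : Fin d → ℤ) : bracket (n + m) ≤ 2 * max (bracket n) (bracket m) := by
  have h1 : ‖n‖ ≤ bracket n := le_max_right _ _
  have h2 : ‖m‖ ≤ bracket m := le_max_right _ _
  have h3 := norm_add_le n m
  have h4 := one_le_bracket n
  have h5 := le_max_left (bracket n) (bracket m)
  have h6 := le_max_right (bracket n) (bracket m)
  exact max_le (by linarith) (by linarith)

lemma bracket_add_rpow_le {s : ℝ} (hs : 0 ≤ s) (n m : Fin d → ℤ) :
    bracket (n + m) ^ s ≤ 2 ^ s * max (bracket n ^ s) (bracket m ^ s) := by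
  have h1 : 0 ≤ max (bracket n) (bracket m) := (bracket_pos n).le.trans (le_max_left _ _)
  refine (Real.rpow_le_rpow (bracket_pos _).le (bracket_add_le n m) hs).trans_eq ?_
  rw [Real.mul_rpow two_pos.le h1]
  congr 1
  rcases le_total (bracket n) (bracket m) with h | h
  · rw [max_eq_right h, max_eq_right (Real.rpow_le_rpow (bracket_pos n).le h hs)]
  · rw [max_eq_left h, max_eq_left (Real.rpow_le_rpow (bracket_pos m).le h hs)]

lemma one_le_bracket_rpow {s : ℝ} (hs : 0 ≤ s) (n : Fin d → ℤ) : 1 ≤ bracket n ^ s :=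
  Real.one_le_rpow (one_le_bracket n) hs

/-- The weight `2^s ⟨n⟩^s`. -/
noncomputable def powWeight (s : ℝ) (n : Fin d → ℤ) : ℝ≥0∞ :=
  ENNReal.ofReal (2 ^ s * bracket n ^ s)

/-- The weight `2^s (1 + t ⟨n⟩^s)`. -/
noncomputable def mixedWeight (s t : ℝ) (n : Fin d → ℤ) : ℝ≥0∞ :=
  ENNReal.ofReal (2 ^ s * (1 + t * bracket n ^ s))

lemma isWeight_ofReal {g : (Fin d → ℤ) → ℝ} (h1 : ∀ n, 1 ≤ g n)
    (h2 : ∀ n m, g (n + m) ≤ g n * g m) : IsWeight fun n => ENNReal.ofReal (g n) := by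
  refine ⟨fun n => by simpa using h1 n, fun n m => ?_⟩
  rw [← ENNReal.ofReal_mul (zero_le_one.trans (h1 n))]
  exact ENNReal.ofReal_le_ofReal (h2 n m)

lemma isWeight_powWeight {s : ℝ} (hs : 0 ≤ s) : IsWeight (powWeight (d := d) s) := by
  have h2 : (1 : ℝ) ≤ 2 ^ s := Real.one_le_rpow one_le_two hs
  refine isWeight_ofReal (fun n => ?_) fun n m => ?_
  · exact one_le_mul_of_one_le_of_one_le h2 (one_le_bracket_rpow hs n)
  · have h3 := bracket_add_rpow_le hs n m
    have h4 := one_le_bracket_rpow hs n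
    have h5 := one_le_bracket_rpow hs m
    have h6 : max (bracket n ^ s) (bracket m ^ s) ≤ bracket n ^ s * bracket m ^ s :=
      max_le (le_mul_of_one_le_right (by linarith) h5) (le_mul_of_one_le_left (by linarith) h4)
    calc (2 : ℝ) ^ s * bracket (n + m) ^ s
        ≤ 2 ^ s * (2 ^ s * (bracket n ^ s * bracket m ^ s)) := by
          gcongr
          exact h3.trans (by gcongr)
      _ = _ := by ring

/-- Doubling of the bracket costs `2^s`, which the prefactor pays for; no constant depends on `t`,
so the same algebra estimates serve at every scale. -/
lemma isWeight_mixedWeight {s t : ℝ} (hs : 0 ≤ s) (ht : 0 ≤ t) :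
    IsWeight (mixedWeight (d := d) s t) := by
  have h2 : (1 : ℝ) ≤ 2 ^ s := Real.one_le_rpow one_le_two hs
  refine isWeight_ofReal (fun n => ?_) fun n m => ?_
  · have := mul_nonneg ht (zero_le_one.trans (one_le_bracket_rpow hs n))
    exact one_le_mul_of_one_le_of_one_le h2 (by linarith)
  · have h3 := bracket_add_rpow_le hs n m
    have h4 := mul_nonneg ht (zero_le_one.trans (one_le_bracket_rpow hs n))
    have h5 := mul_nonneg ht (zero_le_one.trans (one_le_bracket_rpow hs m))
    have h6 : t * max (bracket n ^ s) (bracket m ^ s) ≤ t * bracket n ^ s + t * bracket m ^ s := by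
      rcases max_choice (bracket n ^ s) (bracket m ^ s) with h | h <;> rw [h] <;> linarith
    have h7 : 1 + t * bracket (n + m) ^ s ≤
        2 ^ s * ((1 + t * bracket n ^ s) * (1 + t * bracket m ^ s)) := by
      have h8 := mul_le_mul_of_nonneg_left h3 ht
      have h9 := mul_le_mul_of_nonneg_left h6 (zero_le_one.trans h2)
      nlinarith [mul_nonneg (zero_le_one.trans h2) (mul_nonneg h4 h5)]
    calc (2 : ℝ) ^ s * (1 + t * bracket (n + m) ^ s)
        ≤ 2 ^ s * (2 ^ s * ((1 + t * bracket n ^ s) * (1 + t * bracket m ^ s))) := by gcongr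
      _ = _ := by ring

lemma mixedWeight_le {s t t' : ℝ} (h : t' ≤ t) (n : Fin d → ℤ) :
    mixedWeight s t' n ≤ mixedWeight s t n := by
  have := (Real.rpow_pos_of_pos (bracket_pos n) s).le
  refine ENNReal.ofReal_le_ofReal ?_
  gcongr

/-- Beyond the scale at which the power dominates, the mixed weights decay with the parameter. -/
lemma mixedWeight_mul_le {s y t : ℝ} (hy : 0 ≤ y) {n : Fin d → ℤ}
    (h : 1 ≤ y * t * bracket n ^ s) :
    mixedWeight s (y * t) n ≤ ENNReal.ofReal (2 * y) * mixedWeight s t n := by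
  rw [mixedWeight, mixedWeight, ← ENNReal.ofReal_mul (by positivity)]
  refine ENNReal.ofReal_le_ofReal ?_
  have h2 : 1 + y * t * bracket n ^ s ≤ 2 * y * (1 + t * bracket n ^ s) := by nlinarith
  calc (2 : ℝ) ^ s * (1 + y * t * bracket n ^ s)
      ≤ 2 ^ s * (2 * y * (1 + t * bracket n ^ s)) := by gcongr
    _ = _ := by ring

/-- Up to scale `N` the constant term of the mixed weight suffices; beyond it, `⟨n⟩^(σ-s) ≤
N^(σ-s)`. This converts the scale-dependent bounds into the fixed norm of the theorem. -/
lemma powWeight_le_mul_mixedWeight {s σ N : ℝ} (hσ : 0 ≤ σ) (hs : σ ≤ s) (hN : 0 < N)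
    (n : Fin d → ℤ) : powWeight σ n ≤ ENNReal.ofReal (N ^ σ) * mixedWeight s (N ^ (-s)) n := by
  rw [powWeight, mixedWeight, ← ENNReal.ofReal_mul (by positivity)]
  refine ENNReal.ofReal_le_ofReal ?_
  have hb := bracket_pos n
  have h1 : bracket n ^ σ ≤ N ^ σ * (1 + N ^ (-s) * bracket n ^ s) := by
    rcases le_total (bracket n) N with h | h
    · calc bracket n ^ σ ≤ N ^ σ * 1 := by rw [mul_one]; exact Real.rpow_le_rpow hb.le h hσ
        _ ≤ _ := by
          gcongr
          have : 0 ≤ N ^ (-s) * bracket n ^ s := by positivity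
          linarith
    · calc bracket n ^ σ = bracket n ^ s * bracket n ^ (σ - s) := by
            rw [← Real.rpow_add hb]; ring_nf
        _ ≤ bracket n ^ s * N ^ (σ - s) := by
            gcongr ?_ * ?_
            exact Real.rpow_le_rpow_of_nonpos hN h (sub_nonpos.2 hs)
        _ = N ^ σ * (N ^ (-s) * bracket n ^ s) := by
            rw [sub_eq_add_neg, Real.rpow_add hN]; ring
        _ ≤ _ := mul_le_mul_of_nonneg_left (by linarith) (by positivity)
  calc (2 : ℝ) ^ σ * bracket n ^ σ ≤ 2 ^ s * (N ^ σ * (1 + N ^ (-s) * bracket n ^ s)) := by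
        gcongr
        exact one_le_two
    _ = _ := by ring

end Weights

lemma exists_seq_of_step {α : Type*} {I : ℕ → α → Prop} {r : ℕ → α → α → Prop} {a : α} (h0 : I 0 a)
    (h : ∀ k x, I k x → ∃ y, I (k + 1) y ∧ r k x y) :
    ∃ u : ℕ → α, u 0 = a ∧ (∀ k, I k (u k)) ∧ ∀ k, r k (u k) (u (k + 1)) := by
  have : Nonempty α := ⟨a⟩
  choose! g hg using h
  have hI : ∀ k, I k (Nat.rec a (fun k x => g k x) k : α) := fun k => by
    induction k with
    | zero => exact h0
    | succ k ih => exact (hg k _ ih).1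
  exact ⟨fun k => Nat.rec a (fun k x => g k x) k, rfl, hI, fun k => (hg k _ (hI k)).2⟩

/-! ### The iteration and its bookkeeping -/

section Iteration

variable {d : ℕ} {ω : Fin d → ℝ}

open BKernel

/-- The state of the iteration after `k` steps: the transformation `P`, the correction `f` of the
potential and the remaining perturbation `M`. -/
structure IterationState (V : ℂ → ℂ) (M₀ : BKernel ω) (R v s σ y C E : ℝ) (k : ℕ)
    (x : BKernel ω × BKernel ω × BKernel ω) : Prop where
  hol_transform : x.1 ∈ holSubring ω (R / 2 * (1 + (1 / 2) ^ k))
  hol_potential : x.2.1 ∈ holSubring ω (R / 2 * (1 + (1 / 2) ^ k))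
  hol_remainder : x.2.2 ∈ holSubring ω (R / 2 * (1 + (1 / 2) ^ k))
  isDiagonal : x.2.1.IsDiagonal
  remainder_le : wnorm (mixedWeight s (y ^ k)) x.2.2.1 ≤ ENNReal.ofReal (E * (4 * y) ^ k)
  lipschitz : ∀ z ∈ strip (R / 2 * (1 + (1 / 2) ^ k)), ∀ a : ℝ,
    ‖x.2.1 z 0 - x.2.1 (z - a) 0‖ ≤ v / 2 * (1 - (1 / 2) ^ k) * torusNorm a
  commutator : HasCommutator V (regularPhases ω (R / 2 * (1 + (1 / 2) ^ k)) V) x.1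
    (x.2.1 * x.1 + x.2.2 * x.1 - x.1 * M₀)
  transform_le : wnorm (powWeight σ) (x.1 - 1).1 ≤ ENNReal.ofReal (C * E * (1 - (1 / 2) ^ k))

lemma torusNorm_nonneg (a : ℝ) : 0 ≤ torusNorm a := norm_nonneg _

lemma iterationState_step {V : ℂ → ℂ} {M₀ : BKernel ω} {R v s σ τ γ B x y u C κ E : ℝ}
    (hR : 0 < R) (hv : 0 < v) (hγ : 0 < γ) (hσ : 0 ≤ σ) (hσs : σ ≤ s) (hτ : 0 ≤ τ)
    (hB : 1 ≤ B) (hx : x = B ^ τ) (hu : u = B ^ σ) (hy : y = B ^ (-s))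
    (hyxu : 4 * (y * x * u) ≤ 1 / 2) (hy16 : y ≤ 1 / 16) (hκ : κ = 2 * x / (v * γ))
    (hC : C = 4 * κ)
    (hE0 : 0 ≤ E) (hEκ : κ * E ≤ y / 3) (hER : E ≤ v * R / 16)
    (hV : MeromorphicOn V (strip R)) (hper : ∀ z ∈ strip R, V (z + 1) = V z)
    (hmono : ∀ z ∈ strip R, ∀ a : ℝ, AnalyticAt ℂ V z → AnalyticAt ℂ V (z - a) →
      v * torusNorm a ≤ ‖V z - V (z - a)‖)
    (hω : ∀ n : Fin d → ℤ, n ≠ 0 → γ / bracket n ^ τ ≤ torusNorm (dot n ω))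
    (k : ℕ) (X : BKernel ω × BKernel ω × BKernel ω)
    (hX : IterationState V M₀ R v s σ y C E k X) :
    ∃ X', IterationState V M₀ R v s σ y C E (k + 1) X' ∧
      (wnorm (powWeight σ) (X'.1 - X.1).1 ≤ ENNReal.ofReal (C * E / 2 * (1 / 2) ^ k) ∧
        ‖X'.2.1 - X.2.1‖ ≤ E * (1 / 2) ^ k) := by
  obtain ⟨P, f, M⟩ := X
  obtain ⟨hP, hf, hM, hfd, hMe, hlip, hcomm, hPle⟩ := hX
  simp only at hP hf hM hfd hMe hlip hcomm hPle
  have hB0 : 0 < B := one_pos.trans_le hB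
  have hx1 : 1 ≤ x := hx ▸ Real.one_le_rpow hB hτ
  have hu1 : 1 ≤ u := hu ▸ Real.one_le_rpow hB hσ
  have hy0 : 0 < y := hy ▸ Real.rpow_pos_of_pos hB0 _
  have hy1 : y ≤ 1 := by linarith
  have hs : 0 ≤ s := hσ.trans hσs
  have hκ0 : 0 < κ := by rw [hκ]; positivity
  have hhalf : (0 : ℝ) < (1 / 2) ^ k := by positivity
  have hhalf1 : (1 / 2 : ℝ) ^ k ≤ 1 := pow_le_one₀ (by norm_num) (by norm_num)
  have hxy : 4 * y * x ≤ 1 / 2 := by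
    have : y * x * 1 ≤ y * x * u := by gcongr
    linarith
  set ρ := R / 2 * (1 + (1 / 2) ^ k) with hρ
  set ρ' := R / 2 * (1 + (1 / 2) ^ (k + 1)) with hρ'
  have hρρ' : ρ - ρ' = R / 4 * (1 / 2) ^ k := by rw [hρ, hρ', pow_succ]; ring
  have hρlt : ρ' < ρ := by
    have : 0 < R / 4 * (1 / 2) ^ k := by positivity
    linarith
  have hρR : ρ ≤ R := by
    rw [hρ]; nlinarith
  have hsub : strip ρ' ⊆ strip R := strip_mono (hρlt.le.trans hρR)
  -- The divisor bound up to `⟨n⟩ ≤ B^(k+1)`: half of `v` survives the corrections already made, and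
  -- `x^(k+1) = (B^(k+1))^τ` comes from the Diophantine condition.
  set c := v / 2 * (γ / x ^ (k + 1)) with hc
  have hc0 : 0 < c := by positivity
  set e := E * (4 * y) ^ k with he
  have he0 : 0 ≤ e := by positivity
  have hec : e / c = κ * E * (4 * y * x) ^ k := by
    rw [he, hc, hκ, mul_pow _ x k, pow_succ]
    field_simp
    try ring
  have hecle : e / c ≤ κ * E := by
    rw [hec]
    exact mul_le_of_le_one_right (by positivity) (pow_le_one₀ (by positivity) (by linarith))
  have hNpow : (B ^ (k + 1) : ℝ) ^ τ = x ^ (k + 1) := by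
    rw [hx, ← Real.rpow_natCast, ← Real.rpow_natCast, ← Real.rpow_mul hB0.le,
      ← Real.rpow_mul hB0.le, mul_comm]
  have hsep : ∀ n : Fin d → ℤ, n ≠ 0 → bracket n ≤ B ^ (k + 1) → ∀ z ∈ strip ρ', AnalyticAt ℂ V z →
      AnalyticAt ℂ V (z - (dot n ω : ℂ)) →
      c ≤ ‖V z + f z 0 - (V (z - (dot n ω : ℂ)) + f (z - (dot n ω : ℂ)) 0)‖ := by
    intro n hn hnN z hz h1 h2
    have h3 := hmono z (hsub hz) (dot n ω) h1 h2
    have h4 := hlip z (strip_mono hρlt.le hz) (dot n ω)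
    have h5 : v * torusNorm (dot n ω) - v / 2 * (1 - (1 / 2) ^ k) * torusNorm (dot n ω) ≤
        ‖V z + f z 0 - (V (z - (dot n ω : ℂ)) + f (z - (dot n ω : ℂ)) 0)‖ := by
      have h6 := norm_sub_norm_le (V z - V (z - (dot n ω : ℂ)))
        (-(f z 0 - f (z - (dot n ω : ℂ)) 0))
      rw [norm_neg] at h6
      have h7 : V z - V (z - (dot n ω : ℂ)) - -(f z 0 - f (z - (dot n ω : ℂ)) 0) =
        V z + f z 0 - (V (z - (dot n ω : ℂ)) + f (z - (dot n ω : ℂ)) 0) := by ring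
      rw [h7] at h6
      linarith
    have h8 : v / 2 * torusNorm (dot n ω) ≤
        v * torusNorm (dot n ω) - v / 2 * (1 - (1 / 2) ^ k) * torusNorm (dot n ω) := by
      have := mul_nonneg (mul_nonneg hv.le hhalf.le) (torusNorm_nonneg (dot n ω))
      nlinarith
    have h9 : γ / x ^ (k + 1) ≤ torusNorm (dot n ω) := by
      refine le_trans ?_ (hω n hn)
      have := bracket_pos n
      rw [← hNpow]
      gcongr
    calc c ≤ v / 2 * torusNorm (dot n ω) := by rw [hc]; gcongr
      _ ≤ _ := h8.trans h5
  have hcut : ∀ n : Fin d → ℤ, B ^ (k + 1) < bracket n →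
      mixedWeight s (y ^ (k + 1)) n ≤ ENNReal.ofReal (2 * y) * mixedWeight s (y ^ k) n := by
    intro n hn
    rw [pow_succ']
    refine mixedWeight_mul_le hy0.le ?_
    have h1 : (B ^ (k + 1) : ℝ) ^ s ≤ bracket n ^ s :=
      Real.rpow_le_rpow (by positivity) hn.le hs
    have h2 : (B ^ (k + 1) : ℝ) ^ s = (y ^ (k + 1))⁻¹ := by
      rw [hy, ← Real.rpow_natCast, ← Real.rpow_natCast, ← Real.rpow_mul hB0.le,
        ← Real.rpow_mul hB0.le, ← Real.rpow_neg hB0.le]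
      ring_nf
    rw [← pow_succ', ← div_le_iff₀' (by positivity), one_div, ← h2]
    exact h1
  obtain ⟨W, M', hW, hM', hWle, hM'le, hcomm'⟩ := exists_conjugation_step
    (w := mixedWeight s (y ^ k)) (w' := mixedWeight s (y ^ (k + 1)))
    (isWeight_mixedWeight hs (by positivity)) (fun n => ENNReal.ofReal_ne_top)
    (fun n => mixedWeight_le (pow_le_pow_of_le_one hy0.le hy1 (Nat.le_succ k)) n) hρlt.le
    (hV.mono_set hsub) (fun z hz => hper z (hsub hz)) hf hfd hM hc0 hsep he0 hMe
    (by linarith) (by positivity : 0 ≤ 2 * y) (one_le_pow₀ hB) hcut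
    (hcomm.mono (regularPhases_mono hρlt.le V))
  -- The change of weight costs `u^k`, and `e / c = κE (4yx)^k`; together they give `(4yxu)^k ≤
  -- 2^(-k)`.
  have hWσ : wnorm (powWeight σ) W.1 ≤ ENNReal.ofReal (κ * E * (1 / 2) ^ k) := by
    have h1 : wnorm (powWeight σ) W.1 ≤
        ENNReal.ofReal ((B ^ k : ℝ) ^ σ) * wnorm (mixedWeight s (y ^ k)) W.1 := by
      refine wnorm_le_mul_wnorm fun z n => ?_
      rw [mul_left_comm]
      gcongr
      have h2 : y ^ k = (B ^ k : ℝ) ^ (-s) := by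
        rw [hy, ← Real.rpow_natCast, ← Real.rpow_natCast, ← Real.rpow_mul hB0.le,
          ← Real.rpow_mul hB0.le, mul_comm]
      rw [h2]
      exact powWeight_le_mul_mixedWeight hσ hσs (by positivity) n
    refine h1.trans ((mul_le_mul_right hWle _).trans ?_)
    rw [← ENNReal.ofReal_mul (by positivity)]
    refine ENNReal.ofReal_le_ofReal ?_
    have h3 : (B ^ k : ℝ) ^ σ = u ^ k := by
      rw [hu, ← Real.rpow_natCast, ← Real.rpow_natCast, ← Real.rpow_mul hB0.le,
        ← Real.rpow_mul hB0.le, mul_comm]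
    rw [h3, hec]
    calc u ^ k * (κ * E * (4 * y * x) ^ k) = κ * E * (4 * (y * x * u)) ^ k := by
          rw [mul_left_comm, ← mul_pow]; ring_nf
      _ ≤ _ := by gcongr
  have hCE : C * E ≤ 1 := by rw [hC]; linarith
  have hC0 : 0 < C := by rw [hC]; positivity
  -- The increment is `W P` with `‖P - 1‖ ≤ 1`, hence at most twice the bound on `W`; this is why `C
  -- = 4κ`, so that the increments add up to at most `CE`.
  have hdiff : wnorm (powWeight σ) ((1 + W) * P - P).1 ≤
      ENNReal.ofReal (C * E / 2 * (1 / 2) ^ k) := by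
    have h1 : (1 + W) * P - P = W + W * (P - 1) := by noncomm_ring
    rw [h1]
    have hP1 : wnorm (powWeight σ) (P - 1).1 ≤ ENNReal.ofReal 1 :=
      hPle.trans (ENNReal.ofReal_le_ofReal
        (mul_le_one₀ hCE (by linarith) (by linarith)))
    refine (BKernel.wnorm_add_le (by positivity) (by positivity) hWσ
      (BKernel.wnorm_mul_le (isWeight_powWeight hσ) (by positivity) hWσ hP1)).trans_eq ?_
    rw [hC]
    ring_nf
  have hDnorm : ‖restrict ({0} : Set (Fin d → ℤ)) M‖ ≤ e :=
    norm_le_of_wnorm_le (isWeight_mixedWeight hs (by positivity)).one_le he0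
      ((wnorm_restrict_le _ _ M).trans hMe)
  have h4y : (4 * y) ^ k ≤ (1 / 4) ^ k := by gcongr; linarith
  refine ⟨((1 + W) * P, f + restrict {0} M, M'), ⟨?_, ?_, hM', ?_, ?_, ?_, hcomm', ?_⟩, hdiff, ?_⟩
  · exact mul_mem (add_mem (one_mem _) hW) (holSubring_anti hρlt.le hP)
  · exact add_mem (holSubring_anti hρlt.le hf)
      (restrict_mem_holSubring (holSubring_anti hρlt.le hM) _)
  · exact hfd.add (isDiagonal_restrict_zero M)
  · refine hM'le.trans (ENNReal.ofReal_le_ofReal ?_)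
    -- The tail contributes `2y e` and the quadratic terms at most `6e · y/3 = 2y e`, so the
    -- remainder shrinks by `4y`.
    have h1 : 6 * e * (e / c) ≤ 6 * e * (y / 3) :=
      mul_le_mul_of_nonneg_left (hecle.trans hEκ) (by positivity)
    have h2 : E * (4 * y) ^ (k + 1) = 4 * y * e := by rw [he, pow_succ]; ring
    rw [h2]
    linarith
  · intro z hz a
    have hDm := restrict_mem_holSubring hM ({0} : Set (Fin d → ℤ))
    have h1 := norm_sub_shift_le hρlt (hDm 0).1 (hDm 0).2
      (fun z _ => (entry_le_norm _ z 0).trans hDnorm) hz a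
    have h2 := hlip z (strip_mono hρlt.le hz) a
    -- The strip shrinks by `(R/4) 2^(-k)` while `e` decays at least like `4^(-k)`, so the Cauchy
    -- estimate leaves a summable Lipschitz increment; the increments total at most `v/2`.
    have h3 : e / (ρ - ρ') ≤ v / 2 * (1 / 2) ^ (k + 1) := by
      rw [hρρ', div_le_iff₀ (by positivity)]
      calc e ≤ v * R / 16 * (1 / 4) ^ k := by rw [he]; gcongr
        _ = v / 2 * (1 / 2) ^ (k + 1) * (R / 4 * (1 / 2) ^ k) := by
          rw [pow_succ, show (1 / 4 : ℝ) = 1 / 2 * (1 / 2) by norm_num, mul_pow]; ring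
    have h4 := h1.trans (mul_le_mul_of_nonneg_right h3 (torusNorm_nonneg a))
    have h5 : ∀ p q r t : ℂ, p + q - (r + t) = (p - r) + (q - t) := fun _ _ _ _ => by ring
    simp only [coe_add, Pi.add_apply]
    rw [h5]
    refine (norm_add_le _ _).trans ((add_le_add h2 h4).trans_eq ?_)
    rw [pow_succ]
    ring
  · have h1 : (1 + W) * P - 1 = ((1 + W) * P - P) + (P - 1) := by abel
    simp only
    rw [h1]
    refine (BKernel.wnorm_add_le (by positivity)
      (mul_nonneg (by positivity) (by linarith)) hdiff hPle).trans_eq ?_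
    rw [pow_succ]
    ring_nf
  · simp only [add_sub_cancel_left]
    refine hDnorm.trans ?_
    rw [he]
    gcongr
    linarith

end Iteration

/-! ### Passage to the limit -/

section Diagonalization

variable {d : ℕ} {ω : Fin d → ℝ}

open BKernel

/-- A kernel `U` with inverse `Uinv` and a diagonal kernel `f` with `U (V + M) U⁻¹ = V + f`, with
bounds in terms of a size `E`, on the strip of half-width `r`. -/
structure IsDiagonalization (V : ℂ → ℂ) (r v σ C E : ℝ) (M U Uinv f : BKernel ω) : Prop where
  hol : U ∈ holSubring ω r
  hol_inv : Uinv ∈ holSubring ω r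
  hol_potential : f ∈ holSubring ω r
  mul_inv : U * Uinv = 1
  inv_mul : Uinv * U = 1
  isDiagonal : f.IsDiagonal
  wnorm_le : wnorm (powWeight σ) (U - 1).1 ≤ ENNReal.ofReal (C * E)
  wnorm_inv_le : wnorm (powWeight σ) (Uinv - 1).1 ≤ ENNReal.ofReal (C * E)
  potential_le : ‖f‖ ≤ 2 * E
  lipschitz : ∀ z ∈ strip r, ∀ a : ℝ, ‖f z 0 - f (z - a) 0‖ ≤ v / 2 * torusNorm a
  commutator : HasCommutator V (regularPhases ω r V) U (f * U - U * M)

/-- Diagonalization of `V + M` for small `M`, with constants that depend neither on the dimension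
nor on the frequency. -/
theorem exists_isDiagonalization {R v s σ τ γ η : ℝ} (hR : 0 < R) (hv : 0 < v) (hγ : 0 < γ)
    (hσ : 0 ≤ σ) (hτ : 0 ≤ τ) (hη : 0 < η) (hs : s = σ + τ + η) :
    ∃ C ε : ℝ, 0 < C ∧ 0 < ε ∧ ∀ (d : ℕ) (ω : Fin d → ℝ) (V : ℂ → ℂ) (M : BKernel ω) (E : ℝ),
      0 ≤ E → E ≤ ε → (∀ n : Fin d → ℤ, n ≠ 0 → γ / bracket n ^ τ ≤ torusNorm (dot n ω)) →
      MeromorphicOn V (strip R) → (∀ z ∈ strip R, V (z + 1) = V z) →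
      (∀ z ∈ strip R, ∀ a : ℝ, AnalyticAt ℂ V z → AnalyticAt ℂ V (z - a) →
        v * torusNorm a ≤ ‖V z - V (z - a)‖) →
      M ∈ holSubring ω R → wnorm (mixedWeight s 1) M.1 ≤ ENNReal.ofReal E →
      ∃ U Uinv f : BKernel ω, IsDiagonalization V (R / 2) v σ C E M U Uinv f := by
  -- Chosen so that `yxu = B^(-η) = 1/16`.
  set B : ℝ := 16 ^ (1 / η) with hB
  have hB1 : 1 ≤ B := Real.one_le_rpow (by norm_num) (by positivity)
  have hB0 : 0 < B := one_pos.trans_le hB1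
  set x := B ^ τ with hx
  set u := B ^ σ with hu
  set y := B ^ (-s) with hy
  have hx1 : 1 ≤ x := Real.one_le_rpow hB1 hτ
  have hu1 : 1 ≤ u := Real.one_le_rpow hB1 hσ
  have hy0 : 0 < y := Real.rpow_pos_of_pos hB0 _
  have hyxu : y * x * u = 1 / 16 := by
    rw [hy, hx, hu, ← Real.rpow_add hB0, ← Real.rpow_add hB0, hs, hB,
      ← Real.rpow_mul (by norm_num)]
    have : 1 / η * (-(σ + τ + η) + τ + σ) = -1 := by field_simp; ring
    rw [this, Real.rpow_neg_one]
    norm_num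
  have hy16 : y ≤ 1 / 16 := by
    rw [← hyxu, mul_assoc]
    exact le_mul_of_one_le_right hy0.le (one_le_mul_of_one_le_of_one_le hx1 hu1)
  set κ := 2 * x / (v * γ) with hκ
  have hκ0 : 0 < κ := by positivity
  -- The limit satisfies the bound with `4κ`, and inversion by the Neumann series doubles it. The
  -- first threshold controls the quadratic errors, the second the Lipschitz constant.
  refine ⟨8 * κ, min (y / (3 * κ)) (v * R / 16), by positivity, lt_min (by positivity) (by positivity),
    fun d ω V M E hE0 hE hω hV hper hmono hM hME => ?_⟩
  have hEκ : κ * E ≤ y / 3 := by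
    have := hE.trans (min_le_left _ _)
    rw [le_div_iff₀ (by positivity)] at this
    linarith
  have hER : E ≤ v * R / 16 := hE.trans (min_le_right _ _)
  have h0 : IterationState V M R v s σ y (4 * κ) E 0 (1, 0, M) := by
    refine ⟨one_mem _, zero_mem _, ?_, fun z n _ => rfl, ?_, fun z _ a => ?_, ?_, ?_⟩
    · have : R / 2 * (1 + (1 / 2) ^ 0) = R := by norm_num
      rwa [this]
    · simpa using hME
    · simp
    · simpa using HasCommutator.one
    · simp
  obtain ⟨X, hX0, hX, hstep⟩ := exists_seq_of_step h0 fun k X hX =>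
    iterationState_step hR hv hγ hσ (by linarith) hτ hB1 hx hu hy (by linarith) hy16 hκ rfl hE0 hEκ
      hER hV hper hmono hω k X hX
  have hwσ := isWeight_powWeight (d := d) hσ
  have hUd : ∀ k, dist (X k).1 (X (k + 1)).1 ≤ 4 * κ * E / 2 * (1 / 2) ^ k := fun k => by
    rw [dist_comm, dist_eq_norm]
    exact norm_le_of_wnorm_le hwσ.one_le (by positivity) (hstep k).1
  obtain ⟨U, hU⟩ := cauchySeq_tendsto_of_complete
    (cauchySeq_of_le_geometric (1 / 2) (4 * κ * E / 2) (by norm_num) hUd)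
  have hfd : ∀ k, dist (X k).2.1 (X (k + 1)).2.1 ≤ E * (1 / 2) ^ k := fun k => by
    rw [dist_comm, dist_eq_norm]
    exact (hstep k).2
  obtain ⟨f, hf⟩ := cauchySeq_tendsto_of_complete
    (cauchySeq_of_le_geometric (1 / 2) E (by norm_num) hfd)
  have hMlim : Tendsto (fun k => (X k).2.2) atTop (𝓝 0) := by
    refine squeeze_zero_norm (a := fun k => E * (4 * y) ^ k) (fun k => ?_) ?_
    · exact norm_le_of_wnorm_le (isWeight_mixedWeight (by linarith) (by positivity)).one_le
        (by positivity) (hX k).remainder_le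
    · simpa using (tendsto_pow_atTop_nhds_zero_of_lt_one (by positivity)
        (by linarith : 4 * y < 1)).const_mul E
  have hr : ∀ k : ℕ, R / 2 ≤ R / 2 * (1 + (1 / 2) ^ k) := fun k =>
    le_mul_of_one_le_right (by positivity) (le_add_of_nonneg_right (by positivity))
  have hhol : ∀ {W : BKernel ω} {Y : ℕ → BKernel ω}, Tendsto Y atTop (𝓝 W) →
      (∀ k, Y k ∈ holSubring ω (R / 2 * (1 + (1 / 2) ^ k))) → W ∈ holSubring ω (R / 2) :=
    fun hW hY => (isClosed_holSubring (R / 2)).mem_of_tendsto hW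
      (Eventually.of_forall fun k => holSubring_anti (hr k) (hY k))
  have hUhol := hhol hU fun k => (hX k).hol_transform
  have hUle : wnorm (powWeight σ) (U - 1).1 ≤ ENNReal.ofReal (4 * κ * E) := by
    refine wnorm_le_of_tendsto (hU.sub_const 1) (fun n => ENNReal.ofReal_ne_top)
      (Eventually.of_forall fun k => (hX k).transform_le.trans (ENNReal.ofReal_le_ofReal ?_))
    exact mul_le_of_le_one_right (by positivity)
      (sub_le_self _ (by positivity))
  obtain ⟨Y, hY, hYle, hUY, hYU⟩ := exists_inverse_one_add hwσ (fun n => ENNReal.ofReal_ne_top)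
    (by positivity) (by linarith) hUle (holSubring ω (R / 2)) (isClosed_holSubring _)
    (sub_mem hUhol (one_mem _))
  rw [add_sub_cancel] at hUY hYU
  refine ⟨U, 1 + Y, f, hUhol, add_mem (one_mem _) hY, hhol hf fun k => (hX k).hol_potential, hUY,
    hYU, fun z n hn => ?_, hUle.trans (ENNReal.ofReal_le_ofReal ?_), ?_, ?_, fun z hz a => ?_, ?_⟩
  · exact tendsto_nhds_unique (tendsto_entry hf z n)
      (tendsto_const_nhds.congr fun k => ((hX k).isDiagonal z n hn).symm)
  · have := mul_nonneg hκ0.le hE0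
    linarith
  · rw [add_sub_cancel_left]
    exact hYle.trans_eq (by ring_nf)
  · have := dist_le_of_le_geometric_of_tendsto₀ (1 / 2) E (by norm_num) hfd hf
    rw [hX0, dist_comm, dist_zero_right] at this
    exact this.trans_eq (by ring)
  · refine le_of_tendsto (((tendsto_entry hf z 0).sub (tendsto_entry hf (z - a) 0)).norm)
      (Eventually.of_forall fun k => ((hX k).lipschitz z (strip_mono (hr k) hz) a).trans ?_)
    refine mul_le_mul_of_nonneg_right ?_ (torusNorm_nonneg a)
    exact mul_le_of_le_one_right (by positivity) (sub_le_self _ (by positivity))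
  -- The remainder tends to zero, so `[P, V] = fP + MP - PM₀` becomes `[U, V] = fU - UM₀` in the
  -- limit.
  · refine HasCommutator.of_tendsto (fun k => (hX k).commutator.mono (regularPhases_mono (hr k) V))
      hU ?_
    simpa using ((hf.mul hU).add (hMlim.mul hU)).sub (hU.mul_const M)

end Diagonalization

/-! ### The self-adjoint case and unitarity -/

section Adjoint

variable {d : ℕ} {ω : Fin d → ℝ}

lemma adjoint_shift (A : Kernel d) (z : ℂ) (n l : Fin d → ℤ) :
    adjoint ω A (z - (dot l ω : ℂ)) (n - l) = conj (A (conj z - (dot n ω : ℂ)) (l - n)) := by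
  have h : conj (z - (dot l ω : ℂ)) - (dot (n - l) ω : ℂ) = conj z - (dot n ω : ℂ) := by
    rw [map_sub, Complex.conj_ofReal, dot_sub]; push_cast; ring
  rw [adjoint, h, neg_sub]

lemma adjoint_kmul (A B : Kernel d) :
    adjoint ω (kmul ω A B) = kmul ω (adjoint ω B) (adjoint ω A) := by
  funext z n
  rw [adjoint, kmul, Complex.conj_tsum, kmul,
    ← (Equiv.subRight n).tsum_eq]
  refine tsum_congr fun m => ?_
  rw [adjoint_shift, map_mul, mul_comm, adjoint, Equiv.subRight_apply]
  have h1 : conj z - (dot n ω : ℂ) - (dot (m - n) ω : ℂ) = conj z - (dot m ω : ℂ) := by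
    rw [dot_sub]; push_cast; ring
  have h2 : -n - (m - n) = -m := by abel
  rw [h1, h2]

lemma adjoint_diag {h : ℂ → ℂ} (hh : ∀ z, conj (h (conj z)) = h z) :
    adjoint ω (diag d h) = diag d h := by
  funext z n
  by_cases hn : n = 0
  · subst hn; simp [adjoint, diag, hh]
  · simp [adjoint, diag, hn]

lemma exists_bound_adjoint (A : BKernel ω) (z : ℂ) (n : Fin d → ℤ) : ‖adjoint ω A.1 z n‖ ≤ ‖A‖ := by
  rw [adjoint, RCLike.norm_conj]
  exact A.entry_le_norm _ _

lemma differentiableOn_conj_conj {R : ℝ} {f : ℂ → ℂ} (hf : DifferentiableOn ℂ f (strip R)) :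
    DifferentiableOn ℂ (fun z => conj (f (conj z))) (strip R) := fun z hz => by
  have h := hf.differentiableAt ((isOpen_strip R).mem_nhds (conj_mem_strip_iff.2 hz))
  have h2 := h.conj_conj
  rw [Complex.conj_conj] at h2
  exact h2.differentiableWithinAt

lemma analyticAt_conj {R : ℝ} {V : ℂ → ℂ} (hV : IsSelfAdjointPotential R V) {z : ℂ}
    (hz : z ∈ strip R) (h : AnalyticAt ℂ V z) : AnalyticAt ℂ V (conj z) := by
  rw [Complex.analyticAt_iff_eventually_differentiableAt] at h ⊢
  have hconj : Tendsto (fun x : ℂ => conj x) (𝓝 (conj z)) (𝓝 z) := by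
    simpa using (Complex.continuous_conj.tendsto (conj z))
  filter_upwards [hconj.eventually h, (isOpen_strip R).mem_nhds (conj_mem_strip_iff.2 hz)] with x hx hxs
  have h1 := hx.conj_conj
  rw [Complex.conj_conj] at h1
  refine h1.congr_of_eventuallyEq ?_
  filter_upwards [(isOpen_strip R).mem_nhds hxs] with y hy
  exact (hV y hy).symm

lemma conj_mem_regularPhases {r R : ℝ} (hr : r ≤ R) {V : ℂ → ℂ} (hV : IsSelfAdjointPotential R V)
    {z : ℂ} (hz : z ∈ regularPhases ω r V) : conj z ∈ regularPhases ω r V := by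
  refine ⟨conj_mem_strip_iff.2 hz.1, fun n => ?_⟩
  have := analyticAt_conj hV (strip_mono hr ((sub_ofReal_mem_strip_iff _).2 hz.1)) (hz.2 n)
  simpa using this

/-- A holomorphic square root of the reciprocal of a function close to one. -/
lemma exists_inv_sqrt {r b : ℝ} {g : ℂ → ℂ} (hg : DifferentiableOn ℂ g (strip r))
    (hper : ∀ z ∈ strip r, g (z + 1) = g z) (hconj : ∀ z, conj (g (conj z)) = g z)
    (hb : b ≤ 1 / 2) (hgb : ∀ z ∈ strip r, ‖g z - 1‖ ≤ b) :
    ∃ h k : ℂ → ℂ, DifferentiableOn ℂ h (strip r) ∧ DifferentiableOn ℂ k (strip r) ∧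
      (∀ z ∈ strip r, h (z + 1) = h z) ∧ (∀ z ∈ strip r, k (z + 1) = k z) ∧
      (∀ z, conj (h (conj z)) = h z) ∧ (∀ z, h z * k z = 1) ∧
      (∀ z ∈ strip r, h z * g z * h z = 1) ∧
      (∀ z ∉ strip r, h z = 1 ∧ k z = 1) ∧
      ∀ z ∈ strip r, ‖h z - 1‖ ≤ 2 * b ∧ ‖k z - 1‖ ≤ 2 * b := by
  classical
  have hslit : ∀ z ∈ strip r, g z ∈ Complex.slitPlane := fun z hz => by
    have := Complex.mem_slitPlane_of_norm_lt_one ((hgb z hz).trans_lt (by linarith : b < 1))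
    rwa [add_sub_cancel] at this
  have hlog : ∀ z ∈ strip r, ‖Complex.log (g z)‖ ≤ 3 / 2 * b := fun z hz => by
    have := Complex.norm_log_one_add_half_le_self ((hgb z hz).trans hb)
    rw [add_sub_cancel] at this
    exact this.trans (by have := hgb z hz; gcongr)
  -- The square root halves the logarithm bound to `3b/4`; the exponential at most doubles it, to
  -- `3b/2`.
  have hexp : ∀ w : ℂ, ‖w‖ ≤ 3 / 4 * b → ‖Complex.exp w - 1‖ ≤ 2 * b := fun w hw => by
    have h0 := (norm_nonneg w).trans hw
    exact (Complex.norm_exp_sub_one_le (by linarith)).trans (by linarith)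
  have hd : ∀ c : ℂ, DifferentiableOn ℂ (fun z => Complex.exp (c * Complex.log (g z))) (strip r) :=
    fun c => ((hg.clog hslit).const_mul c).cexp
  refine ⟨fun z => if z ∈ strip r then Complex.exp (-(1 / 2) * Complex.log (g z)) else 1,
    fun z => if z ∈ strip r then Complex.exp (1 / 2 * Complex.log (g z)) else 1,
    (hd _).congr fun z hz => if_pos hz, (hd _).congr fun z hz => if_pos hz, ?_, ?_, ?_, ?_, ?_, ?_, ?_⟩
  · intro z hz
    simp only [if_pos hz, if_pos (add_one_mem_strip_iff.2 hz), hper z hz]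
  · intro z hz
    simp only [if_pos hz, if_pos (add_one_mem_strip_iff.2 hz), hper z hz]
  · intro z
    by_cases hz : z ∈ strip r
    · have h1 : conj (Complex.log (g (conj z))) = Complex.log (g z) := by
        rw [← Complex.log_conj _ (Complex.slitPlane_arg_ne_pi
          (hslit _ (conj_mem_strip_iff.2 hz))), hconj]
      simp only [if_pos hz, if_pos (conj_mem_strip_iff.2 hz), ← Complex.exp_conj, map_mul, h1]
      simp [show conj (2 : ℂ) = 2 from map_ofNat _ 2]
    · simp only [if_neg hz, if_neg (mt conj_mem_strip_iff.1 hz), map_one]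
  · intro z
    by_cases hz : z ∈ strip r
    · simp only [if_pos hz, ← Complex.exp_add]
      simp
    · simp only [if_neg hz, one_mul]
  · intro z hz
    simp only [if_pos hz]
    nth_rewrite 2 [← Complex.exp_log (Complex.slitPlane_ne_zero (hslit z hz))]
    rw [← Complex.exp_add, ← Complex.exp_add]
    refine (congrArg Complex.exp ?_).trans Complex.exp_zero
    ring
  · intro z hz
    simp only [if_neg hz, and_self]
  · intro z hz
    simp only [if_pos hz]
    have := hlog z hz
    constructor <;> refine hexp _ ?_ <;> rw [norm_mul] <;> norm_num <;> linarith

/-- The diagonal bounded kernel of a function that is one off a strip and bounded on it. -/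
lemma wnorm_diag_sub_one_le (w : (Fin d → ℤ) → ℝ≥0∞) {r b : ℝ} {h : ℂ → ℂ}
    (h1 : ∀ z ∉ strip r, h z = 1)
    (hb : ∀ z ∈ strip r, ‖h z - 1‖ ≤ b) :
    wnorm w (diag d h - unit d) ≤ ENNReal.ofReal b * w 0 := by
  have h2 : diag d h - unit d = diag d (fun z => h z - 1) := by
    funext z n
    by_cases hn : n = 0 <;> simp [diag, unit, hn]
  rw [h2]
  refine iSup_le fun z => ?_
  rw [row_diag]
  gcongr
  rw [← ofReal_norm]
  by_cases hz : z ∈ strip r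
  · exact ENNReal.ofReal_le_ofReal (hb z hz)
  · simp [h1 z hz]

open BKernel

/-- The Gram kernel `U U^*` of a diagonalization of a self-adjoint kernel is diagonal and the
new potential is self-adjoint. -/
lemma IsDiagonalization.gram {V : ℂ → ℂ} {r R v σ C E τ γ : ℝ} {M U Uinv f : BKernel ω}
    (hD : IsDiagonalization V r v σ C E M U Uinv f) (hv : 0 < v) (hγ : 0 < γ) (hσ : 0 ≤ σ)
    (hrR : r ≤ R)
    (hV : MeromorphicOn V (strip R))
    (hmono : ∀ z ∈ strip R, ∀ a : ℝ, AnalyticAt ℂ V z → AnalyticAt ℂ V (z - a) →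
      v * torusNorm a ≤ ‖V z - V (z - a)‖)
    (hω : ∀ n : Fin d → ℤ, n ≠ 0 → γ / bracket n ^ τ ≤ torusNorm (dot n ω))
    (hVsa : IsSelfAdjointPotential R V) (hMsa : adjoint ω M.1 = M.1)
    (hCE0 : 0 ≤ C * E) (hCE : C * E ≤ 1 / 6) :
    (∀ z ∈ strip r, ‖kmul ω U.1 (adjoint ω U.1) z 0 - 1‖ ≤ 3 * (C * E)) ∧
    (∀ z ∈ strip r, conj (f (conj z) 0) = f z 0) ∧
    (∀ n, DifferentiableOn ℂ (fun z => kmul ω U.1 (adjoint ω U.1) z n) (strip r)) ∧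
    ∀ z ∈ strip r, ∀ n, n ≠ 0 → kmul ω U.1 (adjoint ω U.1) z n = 0 := by
  have hVr : MeromorphicOn V (strip r) := hV.mono_set (strip_mono hrR)
  set Us := adjoint ω U.1 with hUs
  have hUsb : ∃ K : ℝ, ∀ z n, ‖Us z n‖ ≤ K := ⟨‖U‖, exists_bound_adjoint U⟩
  set G := kmul ω U.1 Us with hG
  have hA : ‖U - 1‖ ≤ C * E :=
    norm_le_of_wnorm_le (isWeight_powWeight hσ).one_le hCE0 hD.wnorm_le
  have hUnorm : ∀ z n, ‖Us z n‖ ≤ 1 + C * E := by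
    intro z n
    have h1 : ∀ z n, ‖U z n‖ ≤ 1 + C * E := by
      intro z n
      have h2 := ((U - 1).entry_le_norm z n).trans hA
      have h3 : U z n = unit d z n + (U - 1) z n := by simp
      have h4 : ‖unit d z n‖ ≤ 1 := by
        rw [unit, diag]; split_ifs <;> simp
      rw [h3]
      exact (norm_add_le _ _).trans (add_le_add h4 h2)
    rw [hUs, adjoint, RCLike.norm_conj]
    exact h1 _ _
  have hG0 : ∀ z, ‖G z 0 - 1‖ ≤ 3 * (C * E) := by
    intro z
    have h1 : HasSum (fun l => (U - 1) z l * Us (z - (dot l ω : ℂ)) (0 - l)) (G z 0 - Us z 0) := by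
      have h2 := (hasSum_kmul (ω := ω) U.finite hUsb z 0).sub
        (hasSum_kmul (ω := ω) (1 : BKernel ω).finite hUsb z 0)
      rw [coe_one, show kmul ω (unit d) Us z 0 = Us z 0 by
        rw [unit, kmul_diag_left, one_mul]] at h2
      refine h2.congr_fun fun l => ?_
      simp [sub_mul]
    have h3 : Summable fun l => ‖(U - 1) z l‖ :=
      ENNReal.tsum_coe_ne_top_iff_summable_coe.1 (tsum_enorm_row_lt_top (U - 1).finite z).ne
    have h4 : ‖G z 0 - Us z 0‖ ≤ C * E * (1 + C * E) := by
      rw [← h1.tsum_eq]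
      refine (tsum_of_norm_bounded (h3.hasSum.mul_right (1 + C * E)) fun l => ?_).trans ?_
      · rw [norm_mul]
        gcongr
        exact hUnorm _ _
      · gcongr
        exact (h3.tsum_le_of_sum_le fun s => (U - 1).sum_norm_le_norm z s).trans hA
    have h5 : ‖Us z 0 - 1‖ ≤ C * E := by
      have h6 : Us z 0 - 1 = conj ((U - 1) (conj z) 0) := by
        simp [hUs, adjoint, unit, diag]
      rw [h6, RCLike.norm_conj]
      exact ((U - 1).entry_le_norm _ _).trans hA
    have h7 : G z 0 - 1 = (G z 0 - Us z 0) + (Us z 0 - 1) := by ring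
    rw [h7]
    refine (norm_add_le _ _).trans ((add_le_add h4 h5).trans ?_)
    nlinarith
  have hGd : ∀ n, DifferentiableOn ℂ (fun z => G z n) (strip r) := by
    intro n
    refine differentiableOn_tsum_of_sum_norm_le (C := ‖U‖ * ‖U‖) (isOpen_strip r)
      (fun l => (hD.hol l).1.mul ?_) fun z _ s => ?_
    · have h1 := differentiableOn_conj_conj (differentiableOn_comp_sub (hD.hol (l - n)).1 (dot n ω))
      exact h1.congr fun z _ => adjoint_shift U.1 z n l
    · calc ∑ l ∈ s, ‖U z l * Us (z - (dot l ω : ℂ)) (n - l)‖ ≤ ∑ l ∈ s, ‖U z l‖ * ‖U‖ := by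
            refine Finset.sum_le_sum fun l _ => ?_
            rw [norm_mul]
            gcongr
            exact exists_bound_adjoint U _ _
        _ = (∑ l ∈ s, ‖U z l‖) * ‖U‖ := by rw [Finset.sum_mul]
        _ ≤ ‖U‖ * ‖U‖ := by
            gcongr
            exact U.sum_norm_le_norm z s
  set p : ℂ → ℂ := fun z => V z + f z 0 with hp
  have hrow : ∀ z ∈ regularPhases ω r V, ∀ l,
      p z * U z l = U z l * V (z - (dot l ω : ℂ)) + (U * M) z l := by
    intro z hz l
    have := hD.commutator z hz l
    rw [coe_sub, Pi.sub_apply, Pi.sub_apply, hD.isDiagonal.mul_apply] at this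
    linear_combination -this
  -- This is `p G = G p^*`. Insert the row identity at `z` and the conjugate one at `z'`: the `V`
  -- terms cancel for each `l` by self-adjointness of `V`, and what is left sums to `(UM)U^* -
  -- U(UM)^* = 0`.
  have hGeq : ∀ z ∈ regularPhases ω r V, ∀ n,
      G z n * (p z - conj (p (conj z - (dot n ω : ℂ)))) = 0 := by
    intro z hz n
    have hz' := regularPhases_sub (conj_mem_regularPhases hrR hVsa hz) n
    set z' := conj z - (dot n ω : ℂ) with hz'def
    have h1 : kmul ω (U * M).1 Us = kmul ω U.1 (adjoint ω (U * M).1) := by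
      rw [coe_mul, adjoint_kmul, hMsa]
      exact kmul_assoc U.finite M.finite hUsb
    have h2 := hasSum_kmul (ω := ω) (U * M).finite hUsb z n
    have h3 := hasSum_kmul (ω := ω) U.finite
      (B := adjoint ω (U * M).1) ⟨‖U * M‖, exists_bound_adjoint (U * M)⟩ z n
    rw [← h1] at h3
    have h4 := h2.sub h3
    rw [sub_self] at h4
    refine ((hasSum_kmul (ω := ω) U.finite hUsb z n).mul_right _).unique (h4.congr_fun fun l => ?_)
    rw [hUs, adjoint_shift, adjoint_shift, ← hz'def]
    have h5 := hrow z hz l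
    have h6 := congrArg conj (hrow z' hz' (l - n))
    have h7 : conj (V (z' - (dot (l - n) ω : ℂ))) = V (z - (dot l ω : ℂ)) := by
      rw [← hVsa _ (strip_mono hrR ((sub_ofReal_mem_strip_iff _).2 hz.1))]
      congr 2
      rw [hz'def, dot_sub]
      simp
    rw [map_mul, map_add _ (U z' (l - n) * _), map_mul, h7] at h6
    linear_combination conj (U z' (l - n)) * h5 - U z l * h6
  have hpsa : ∀ z ∈ regularPhases ω r V, conj (p (conj z)) = p z := by
    intro z hz
    have h1 := hGeq z hz 0
    have h2 : G z 0 ≠ 0 := by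
      intro h
      have := hG0 z
      rw [h, zero_sub, norm_neg, norm_one] at this
      linarith
    rw [dot_zero, Complex.ofReal_zero, sub_zero] at h1
    exact (sub_eq_zero.1 ((mul_eq_zero.1 h1).resolve_left h2)).symm
  -- Now `p` is self-adjoint, so the factor is `p(z) - p(z - n·ω)`. Were it zero, monotonicity of
  -- `V` would give `v‖n·ω‖ ≤ (v/2)‖n·ω‖` with `‖n·ω‖ > 0`.
  have hcommon : ∀ z ∈ regularPhases ω r V, ∀ n, n ≠ 0 → G z n = 0 := by
    intro z hz n hn
    have h1 := hGeq z hz n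
    have h2 := hpsa _ (regularPhases_sub hz n)
    rw [map_sub, Complex.conj_ofReal] at h2
    rw [h2] at h1
    refine (mul_eq_zero.1 h1).resolve_right (sub_ne_zero.2 fun h => ?_)
    have h3 := hmono z (strip_mono hrR hz.1) (dot n ω) (by simpa using hz.2 0) (hz.2 n)
    have h4 := hD.lipschitz z hz.1 (dot n ω)
    have h5 : 0 < torusNorm (dot n ω) :=
      lt_of_lt_of_le (div_pos hγ (Real.rpow_pos_of_pos (bracket_pos n) τ)) (hω n hn)
    have h6 : V z - V (z - (dot n ω : ℂ)) = -(f z 0 - f (z - (dot n ω : ℂ)) 0) := by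
      simp only [hp] at h
      linear_combination h
    rw [h6, norm_neg] at h3
    have := mul_pos hv h5
    linarith
  refine ⟨fun z _ => hG0 z, ?_, hGd, fun z hz n hn => ?_⟩
  · have hfd := (hD.hol_potential 0).1
    refine eqOn_strip_of_eqOn_regularPhases (ω := ω) hVr
      (differentiableOn_conj_conj hfd).continuousOn hfd.continuousOn fun z hz => ?_
    have h1 := hpsa z hz
    have h2 := hVsa z (strip_mono hrR hz.1)
    simp only [hp, map_add, h2] at h1
    exact add_left_cancel h1
  · exact eqOn_strip_of_eqOn_regularPhases (ω := ω) hVr (g := fun _ => 0)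
      (hGd n).continuousOn continuousOn_const (fun z hz => hcommon z hz n hn) hz

/-- A diagonalization of a self-adjoint kernel can be made unitary. -/
lemma IsDiagonalization.exists_unitary {V : ℂ → ℂ} {r R v σ C E τ γ : ℝ} {M U Uinv f : BKernel ω}
    (hD : IsDiagonalization V r v σ C E M U Uinv f) (hv : 0 < v) (hγ : 0 < γ) (hσ : 0 ≤ σ)
    (hrR : r ≤ R)
    (hV : MeromorphicOn V (strip R))
    (hmono : ∀ z ∈ strip R, ∀ a : ℝ, AnalyticAt ℂ V z → AnalyticAt ℂ V (z - a) →
      v * torusNorm a ≤ ‖V z - V (z - a)‖)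
    (hω : ∀ n : Fin d → ℤ, n ≠ 0 → γ / bracket n ^ τ ≤ torusNorm (dot n ω))
    (hVsa : IsSelfAdjointPotential R V) (hMsa : adjoint ω M.1 = M.1)
    (hCE0 : 0 ≤ C * E) (hCE : C * E ≤ 1 / 6) :
    ∃ U' Uinv' : BKernel ω, IsDiagonalization V r v σ (C * (1 + 12 * 2 ^ σ)) E M U' Uinv' f ∧
      IsUnitaryKernel ω r U'.1 ∧ ∀ z ∈ strip r, conj (f (conj z) 0) = f z 0 := by
  obtain ⟨hG0, hfsa, hGd, hGn⟩ := hD.gram hv hγ hσ hrR hV hmono hω hVsa hMsa hCE0 hCE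
  set G := kmul ω U.1 (adjoint ω U.1) with hG
  have hGapply : ∀ z, G z 0 = ∑' l, U z l * conj (U (conj z) l) := by
    intro z
    refine tsum_congr fun l => ?_
    rw [adjoint_shift]
    simp
  have hGconj : ∀ z, conj (G (conj z) 0) = G z 0 := by
    intro z
    rw [hGapply, hGapply, Complex.conj_tsum]
    refine tsum_congr fun l => ?_
    simp [mul_comm]
  have hGper : ∀ z ∈ strip r, G (z + 1) 0 = G z 0 := by
    intro z hz
    rw [hGapply, hGapply]
    refine tsum_congr fun l => ?_
    rw [map_add, map_one, (hD.hol l).2 z hz, (hD.hol l).2 _ (conj_mem_strip_iff.2 hz)]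
  obtain ⟨h, k, hhd, hkd, hhper, hkper, hhconj, hhk, hhg, hone, hb⟩ :=
    exists_inv_sqrt (hGd 0) hGper hGconj (by linarith) hG0
  have hwσ := isWeight_powWeight (d := d) hσ
  have hw0 : powWeight (d := d) σ 0 = ENNReal.ofReal (2 ^ σ) := by simp [powWeight, bracket]
  have hbound : ∀ q : ℂ → ℂ, (∀ z ∉ strip r, q z = 1) →
      (∀ z ∈ strip r, ‖q z - 1‖ ≤ 2 * (3 * (C * E))) →
      wnorm (powWeight σ) (diag d q - unit d) ≤ ENNReal.ofReal (6 * (C * E) * 2 ^ σ) := by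
    intro q hq1 hq2
    refine (wnorm_diag_sub_one_le _ hq1 hq2).trans_eq ?_
    rw [hw0, ← ENNReal.ofReal_mul (by positivity)]
    ring_nf
  have hfin : ∀ q : ℂ → ℂ, (∀ z ∉ strip r, q z = 1) →
      (∀ z ∈ strip r, ‖q z - 1‖ ≤ 2 * (3 * (C * E))) → wnorm 1 (diag d q) < ⊤ := by
    intro q hq1 hq2
    have h1 : diag d q = (diag d q - unit d) + unit d := (sub_add_cancel _ _).symm
    rw [h1]
    refine (HolKernel.wnorm_add_le _ _ _).trans_lt (ENNReal.add_lt_top.2 ⟨?_, ?_⟩)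
    · exact (wnorm_weight_mono hwσ.one_le _).trans_lt ((hbound q hq1 hq2).trans_lt
        ENNReal.ofReal_lt_top)
    · rw [wnorm_unit]; simp
  have hh1 := hbound h (fun z hz => (hone z hz).1) fun z hz => (hb z hz).1
  have hk1 := hbound k (fun z hz => (hone z hz).2) fun z hz => (hb z hz).2
  set H : BKernel ω := ⟨diag d h, hfin h (fun z hz => (hone z hz).1) fun z hz => (hb z hz).1⟩ with hH
  set K : BKernel ω := ⟨diag d k, hfin k (fun z hz => (hone z hz).2) fun z hz => (hb z hz).2⟩ with hK
  have hHK : H * K = 1 := by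
    ext z n
    rw [coe_mul, kmul_diag_left]
    by_cases hn : n = 0
    · subst hn; simp [hK, diag, unit, hhk]
    · simp [hK, diag, unit, hn]
  have hKH : K * H = 1 := by
    ext z n
    rw [coe_mul, kmul_diag_left]
    by_cases hn : n = 0
    · subst hn; simp [hH, diag, unit, mul_comm (k z), hhk]
    · simp [hH, diag, unit, hn]
  have hdiag : ∀ q : ℂ → ℂ, DifferentiableOn ℂ q (strip r) → (∀ z ∈ strip r, q (z + 1) = q z) →
      ∀ n, DifferentiableOn ℂ (fun z => diag d q z n) (strip r) ∧
        ∀ z ∈ strip r, diag d q (z + 1) n = diag d q z n := by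
    intro q hq1 hq2 n
    by_cases hn : n = 0
    · simpa only [diag, hn, if_true] using ⟨hq1, hq2⟩
    · simpa only [diag, hn, if_false] using ⟨differentiableOn_const (0 : ℂ), fun _ _ => trivial⟩
  have hHm : H ∈ holSubring ω r := hdiag h hhd hhper
  have hKm : K ∈ holSubring ω r := hdiag k hkd hkper
  have hfH : f * H = H * f := by
    ext z n
    rw [hD.isDiagonal.mul_apply, coe_mul, kmul_diag_left]
    by_cases hn : n = 0
    · subst hn; simp [hH, diag, mul_comm]
    · simp [hH, diag, hn, hD.isDiagonal z n hn]
  have hUle := hD.wnorm_le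
  have hUile := hD.wnorm_inv_le
  have h2σ : (0 : ℝ) < 2 ^ σ := by positivity
  -- The cross term is at most `6(CE) 2^σ` because `CE ≤ 1`; hence the factor `1 + 12 · 2^σ`.
  have hsmall : ∀ A B : BKernel ω, wnorm (powWeight σ) (A - 1).1 ≤ ENNReal.ofReal (C * E) →
      wnorm (powWeight σ) (B - 1).1 ≤ ENNReal.ofReal (6 * (C * E) * 2 ^ σ) →
      wnorm (powWeight σ) (A * B - 1).1 ≤ ENNReal.ofReal (C * (1 + 12 * 2 ^ σ) * E) ∧
      wnorm (powWeight σ) (B * A - 1).1 ≤ ENNReal.ofReal (C * (1 + 12 * 2 ^ σ) * E) := by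
    intro A B hA hB
    have h0 : 0 ≤ 6 * (C * E) * 2 ^ σ := by positivity
    have h1 : A * B - 1 = (A - 1) + ((B - 1) + (A - 1) * (B - 1)) := by noncomm_ring
    have h2 : B * A - 1 = (A - 1) + ((B - 1) + (B - 1) * (A - 1)) := by noncomm_ring
    have h3 : C * E * (6 * (C * E) * 2 ^ σ) ≤ 1 * (6 * (C * E) * 2 ^ σ) := by
      gcongr; linarith
    constructor
    · rw [h1]
      refine (BKernel.wnorm_add_le hCE0 (by positivity) hA (BKernel.wnorm_add_le h0
        (mul_nonneg hCE0 h0) hB (BKernel.wnorm_mul_le hwσ hCE0 hA hB))).trans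
        (ENNReal.ofReal_le_ofReal ?_)
      linarith
    · rw [h2]
      refine (BKernel.wnorm_add_le hCE0 (by positivity) hA (BKernel.wnorm_add_le h0
        (mul_nonneg h0 hCE0) hB (BKernel.wnorm_mul_le hwσ h0 hB hA))).trans
        (ENNReal.ofReal_le_ofReal ?_)
      linarith
  have hinv1 : H * U * (Uinv * K) = 1 := by
    rw [mul_assoc, ← mul_assoc U, hD.mul_inv, one_mul, hHK]
  have hinv2 : Uinv * K * (H * U) = 1 := by
    rw [mul_assoc, ← mul_assoc K, hKH, one_mul, hD.inv_mul]
  -- Left multiplication by the diagonal `H = G^(-1/2)` normalizes the Gram kernel, and `f` is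
  -- unchanged because diagonal kernels commute.
  refine ⟨H * U, Uinv * K, ⟨mul_mem hHm hD.hol, mul_mem hD.hol_inv hKm, hD.hol_potential, hinv1,
    hinv2, hD.isDiagonal, (hsmall U H hUle hh1).2, (hsmall Uinv K hUile hk1).1, hD.potential_le,
    hD.lipschitz, ?_⟩, ?_, hfsa⟩
  · have hHc : HasCommutator V (regularPhases ω r V) H 0 := fun z _ n => by
      by_cases hn : n = 0
      · subst hn; simp
      · simp [hH, diag, hn]
    have h1 := HasCommutator.mul (fun z hz l => regularPhases_sub hz l) hHc hD.commutator
    convert h1 using 1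
    rw [zero_mul, add_zero, mul_sub, ← mul_assoc, hfH, mul_assoc, mul_assoc]
  · set X := adjoint ω (H * U).1 with hX
    have hXb : ∃ L : ℝ, ∀ z n, ‖X z n‖ ≤ L := ⟨‖H * U‖, exists_bound_adjoint (H * U)⟩
    have hXeq : X = kmul ω (adjoint ω U.1) (diag d h) := by
      rw [hX, coe_mul, adjoint_kmul, adjoint_diag hhconj]
    have hUX : ∀ z ∈ strip r, ∀ n, kmul ω (H * U).1 X z n = unit d z n := by
      intro z hz n
      have h1 : kmul ω (H * U).1 X z n = h z * G z n * h (z - (dot n ω : ℂ)) := by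
        refine (hasSum_kmul (H * U).finite hXb z n).unique ?_
        have h2 := ((hasSum_kmul (ω := ω) U.finite
          (B := adjoint ω U.1) ⟨‖U‖, exists_bound_adjoint U⟩ z n).mul_left (h z)).mul_right
          (h (z - (dot n ω : ℂ)))
        refine h2.congr_fun fun l => ?_
        rw [hXeq, kmul_diag_right, coe_mul, kmul_diag_left]
        have h3 : z - (dot l ω : ℂ) - (dot (n - l) ω : ℂ) = z - (dot n ω : ℂ) := by
          rw [dot_sub]; push_cast; ring
        rw [h3]
        ring
      rw [h1]
      by_cases hn : n = 0
      · subst hn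
        simpa [unit, diag] using hhg z hz
      · rw [hGn z hz n hn]
        simp [unit, diag, hn]
    -- On the strip the adjoint is a right inverse of `H U`, hence equals its two-sided inverse
    -- `Uinv * K`. The other half of unitarity follows.
    have hXU : ∀ z ∈ strip r, ∀ n, X z n = (Uinv * K) z n := by
      intro z hz n
      have h1 := kmul_assoc (ω := ω) (Uinv * K).finite (H * U).finite hXb
      rw [← coe_mul, hinv2, coe_one] at h1
      have h2 : kmul ω (unit d) X z n = X z n := by rw [unit, kmul_diag_left, one_mul]
      rw [← h2, h1]
      have h3 : (Uinv * K) z n = (Uinv * K * 1 : BKernel ω) z n := by rw [mul_one]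
      rw [h3]
      refine tsum_congr fun l => ?_
      rw [hUX _ ((sub_ofReal_mem_strip_iff _).2 hz)]
      rfl
    refine ⟨fun z hz n => ?_, fun z hz n => ?_⟩
    · rw [← hUX z hz n]
      exact hasSum_kmul (H * U).finite hXb z n
    · have h1 := (Uinv * K).hasSum_mul (H * U) z n
      rw [hinv2] at h1
      refine h1.congr_fun fun l => ?_
      rw [← hX, hXU z hz l]

end Adjoint

/-! ### The corrected potential as a monotone meromorphic function -/

section Potential

variable {d : ℕ} {ω : Fin d → ℝ}

open Classical in
/-- The meromorphic function `V + g` in normal form, for a meromorphic function `V` in normal form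
and a holomorphic function `g`. -/
noncomputable def addHol (V g : ℂ → ℂ) : ℂ → ℂ := fun z => if AnalyticAt ℂ V z then V z + g z else 0

lemma addHol_of_analyticAt {V g : ℂ → ℂ} {z : ℂ} (h : AnalyticAt ℂ V z) :
    addHol V g z = V z + g z := if_pos h

lemma addHol_of_not_analyticAt {V g : ℂ → ℂ} {z : ℂ} (h : ¬AnalyticAt ℂ V z) :
    addHol V g z = 0 := if_neg h

lemma analyticAt_addHol {V g : ℂ → ℂ} {z : ℂ} (hV : AnalyticAt ℂ V z) (hg : AnalyticAt ℂ g z) :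
    AnalyticAt ℂ (addHol V g) z := by
  refine (hV.add hg).congr ?_
  filter_upwards [hV.eventually_analyticAt] with x hx
  exact (addHol_of_analyticAt hx).symm

/-- A holomorphic summand cannot cancel a negative order. The poles of the new potential are
therefore exactly those of `V`. -/
lemma addHol_poles {V g : ℂ → ℂ} {z : ℂ} (hV : MeromorphicNFAt V z) (hVz : ¬AnalyticAt ℂ V z)
    (hg : AnalyticAt ℂ g z) : MeromorphicAt (addHol V g) z ∧
      meromorphicOrderAt (addHol V g) z < 0 := by
  have hneg : meromorphicOrderAt V z < 0 := by
    rw [← not_le, hV.meromorphicOrderAt_nonneg_iff_analyticAt]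
    exact hVz
  have heq : V + g =ᶠ[𝓝[≠] z] addHol V g := by
    filter_upwards [hV.meromorphicAt.eventually_analyticAt] with x hx
    exact (addHol_of_analyticAt hx).symm
  refine ⟨(hV.meromorphicAt.add hg.meromorphicAt).congr heq, ?_⟩
  rw [← meromorphicOrderAt_congr heq, meromorphicOrderAt_add_eq_left_of_lt hg.meromorphicAt
    (hneg.trans_le hg.meromorphicOrderAt_nonneg)]
  exact hneg

lemma analyticAt_addHol_iff {V g : ℂ → ℂ} {z : ℂ} (hV : MeromorphicNFAt V z)
    (hg : AnalyticAt ℂ g z) : AnalyticAt ℂ (addHol V g) z ↔ AnalyticAt ℂ V z := by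
  refine ⟨fun h => ?_, fun h => analyticAt_addHol h hg⟩
  by_contra hVz
  exact absurd h.meromorphicOrderAt_nonneg (not_le.2 (addHol_poles hV hVz hg).2)

lemma meromorphicNFAt_addHol {V g : ℂ → ℂ} {z : ℂ} (hV : MeromorphicNFAt V z)
    (hg : AnalyticAt ℂ g z) : MeromorphicNFAt (addHol V g) z := by
  by_cases h : AnalyticAt ℂ V z
  · exact (analyticAt_addHol h hg).meromorphicNFAt
  · obtain ⟨h1, h2⟩ := addHol_poles hV h hg
    exact meromorphicNFAt_iff_analyticAt_or.2 (Or.inr ⟨h1, h2, addHol_of_not_analyticAt h⟩)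

lemma analyticAt_of_add_one {R : ℝ} {V : ℂ → ℂ} (hper : ∀ z ∈ strip R, V (z + 1) = V z) {z : ℂ}
    (hz : z ∈ strip R) (h : AnalyticAt ℂ V (z + 1)) : AnalyticAt ℂ V z := by
  have h1 : AnalyticAt ℂ (fun w => V (w + 1)) z :=
    AnalyticAt.fun_comp (f := fun w => w + 1) h (by fun_prop)
  refine h1.congr ?_
  filter_upwards [(isOpen_strip R).mem_nhds hz] with w hw
  exact hper w hw

/-- The supremum is itself admissible: for fixed `z` and `a` the condition on the constant is
closed. -/
lemma monotoneConst_mul_le {R : ℝ} {V : ℂ → ℂ} (hV : (monotoneConsts R V).Nonempty) {z : ℂ}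
    (hz : z ∈ strip R) (a : ℝ) (h1 : AnalyticAt ℂ V z) (h2 : AnalyticAt ℂ V (z - a)) :
    monotoneConst R V * torusNorm a ≤ ‖V z - V (z - a)‖ := by
  rcases (torusNorm_nonneg a).eq_or_lt with h | h
  · rw [← h, mul_zero]; exact norm_nonneg _
  · rw [← le_div_iff₀ h]
    refine csSup_le hV fun c hc => ?_
    rw [le_div_iff₀ h]
    exact hc.2 z hz a h1 h2

/-- Needed to bound the real `sSup` from below by a member. The shift `a = 1/2` at one phase regular
for both values gives an upper bound. -/
lemma bddAbove_monotoneConsts {R : ℝ} (hR : 0 < R) {V : ℂ → ℂ} (hV : MeromorphicOn V (strip R)) :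
    BddAbove (monotoneConsts R V) := by
  have h0 : (0 : ℂ) ∈ strip R := by simpa [strip] using hR
  have h0' : (0 : ℂ) - ((1 / 2 : ℝ) : ℂ) ∈ strip R := (sub_ofReal_mem_strip_iff _).2 h0
  obtain ⟨z, hz, h1, h2⟩ : ∃ z, z ∈ strip R ∧ AnalyticAt ℂ V z ∧
      AnalyticAt ℂ V (z - ((1 / 2 : ℝ) : ℂ)) := by
    have h3 : ∀ᶠ x in 𝓝[≠] (0 : ℂ), x ∈ strip R ∧ AnalyticAt ℂ V x ∧
        AnalyticAt ℂ V (x - ((1 / 2 : ℝ) : ℂ)) := by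
      filter_upwards [nhdsWithin_le_nhds ((isOpen_strip R).mem_nhds h0),
        (hV 0 h0).eventually_analyticAt, eventually_analyticAt_sub (hV _ h0')] with x a b c
      exact ⟨a, b, c⟩
    exact h3.exists
  have hhalf : torusNorm (1 / 2) = 1 / 2 := by
    have := AddCircle.norm_half_period_eq (1 : ℝ)
    simpa [torusNorm] using this
  refine ⟨‖V z - V (z - ((1 / 2 : ℝ) : ℂ))‖ * 2, fun c hc => ?_⟩
  have := hc.2 z hz (1 / 2) h1 h2
  rw [hhalf] at this
  linarith

/-- A perturbation with small Lipschitz constant preserves half the monotonicity. -/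
lemma isMonotonePotential_addHol {r R v : ℝ} (hr : 0 < r) (hrR : r ≤ R) (hv : 0 < v) {V g : ℂ → ℂ}
    (hV : IsMonotonePotential R V) (hvV : monotoneConst R V = v)
    (hg : DifferentiableOn ℂ g (strip r)) (hgper : ∀ z ∈ strip r, g (z + 1) = g z)
    (hlip : ∀ z ∈ strip r, ∀ a : ℝ, ‖g z - g (z - a)‖ ≤ v / 2 * torusNorm a) :
    IsMonotonePotential r (addHol V g) ∧ v / 2 ≤ monotoneConst r (addHol V g) := by
  have hga : ∀ z ∈ strip r, AnalyticAt ℂ g z := fun z hz =>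
    hg.analyticAt ((isOpen_strip r).mem_nhds hz)
  have hNF : MeromorphicNFOn (addHol V g) (strip r) := fun z hz =>
    meromorphicNFAt_addHol (hV.meromorphic (strip_mono hrR hz)) (hga z hz)
  have hiff : ∀ z ∈ strip r, (AnalyticAt ℂ (addHol V g) z ↔ AnalyticAt ℂ V z) := fun z hz =>
    analyticAt_addHol_iff (hV.meromorphic (strip_mono hrR hz)) (hga z hz)
  have hmem : v / 2 ∈ monotoneConsts r (addHol V g) := by
    refine ⟨half_pos hv, fun z hz a h1 h2 => ?_⟩
    rw [hiff z hz] at h1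
    rw [hiff _ ((sub_ofReal_mem_strip_iff a).2 hz)] at h2
    rw [addHol_of_analyticAt h1, addHol_of_analyticAt h2]
    have h3 := monotoneConst_mul_le hV.monotone (strip_mono hrR hz) a h1 h2
    rw [hvV] at h3
    have h4 := hlip z hz a
    have h5 := norm_sub_norm_le (V z - V (z - a)) (-(g z - g (z - a)))
    rw [norm_neg] at h5
    have h6 : V z + g z - (V (z - a) + g (z - a)) = V z - V (z - a) - -(g z - g (z - a)) := by ring
    rw [h6]
    linarith
  refine ⟨⟨hNF, fun z hz => ?_, ⟨_, hmem⟩⟩,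
    le_csSup (bddAbove_monotoneConsts hr hNF.meromorphicOn) hmem⟩
  have hzR := strip_mono hrR hz
  by_cases h : AnalyticAt ℂ V z
  · rw [addHol_of_analyticAt h, addHol_of_analyticAt (analyticAt_add_one hV.periodic hzR h),
      hV.periodic z hzR, hgper z hz]
  · have h' : ¬AnalyticAt ℂ V (z + 1) := fun h1 => h (analyticAt_of_add_one hV.periodic hzR h1)
    rw [addHol_of_not_analyticAt h, addHol_of_not_analyticAt h']

end Potential

/-! ### Return to the norms on the strip and the conjugation identity -/

section Conclusion

variable {d : ℕ} {ω : Fin d → ℝ}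

open BKernel

lemma kernelNorm_eq (r s : ℝ) (A : Kernel d) :
    kernelNorm r s A = ⨆ z ∈ strip r, ∑' n, ‖A z n‖ₑ * ENNReal.ofReal (bracket n ^ s) := by
  simp only [kernelNorm, ENNReal.ofReal_mul (norm_nonneg _), ofReal_norm]

lemma kernelNorm_le_wnorm {s : ℝ} (hs : 0 ≤ s) (r : ℝ) (A : Kernel d) :
    kernelNorm r s A ≤ wnorm (powWeight s) A := by
  rw [kernelNorm_eq]
  refine iSup₂_le fun z _ => le_trans ?_ (row_le_wnorm _ A z)
  refine ENNReal.tsum_le_tsum fun n => ?_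
  gcongr
  refine ENNReal.ofReal_le_ofReal ?_
  exact le_mul_of_one_le_left (Real.rpow_nonneg (bracket_pos n).le s)
    (Real.one_le_rpow one_le_two hs)

lemma isHolKernel_of_mem {r s a : ℝ} (hs : 0 ≤ s) {A : BKernel ω} (hA : A ∈ holSubring ω r)
    (h : wnorm (powWeight s) (A - 1).1 ≤ ENNReal.ofReal a) : IsHolKernel r s A.1 := by
  refine ⟨fun n => ⟨(hA n).2, (hA n).1, ‖A‖, fun z _ => A.entry_le_norm z n⟩, ?_⟩
  refine (kernelNorm_le_wnorm hs r A.1).trans_lt ?_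
  have h1 : A.1 = (A - 1).1 + unit d := by simp
  rw [h1]
  refine (HolKernel.wnorm_add_le _ _ _).trans_lt (ENNReal.add_lt_top.2
    ⟨h.trans_lt ENNReal.ofReal_lt_top, ?_⟩)
  rw [wnorm_unit]
  exact ENNReal.ofReal_lt_top

open Classical in
/-- A holomorphic kernel on a strip, extended by zero, as a bounded kernel. -/
lemma exists_cut {R s : ℝ} (hs : 0 ≤ s) {M : Kernel d} (hM : IsHolKernel R s M) :
    ∃ M₀ : BKernel ω, M₀ ∈ holSubring ω R ∧ (∀ z ∈ strip R, ∀ n, M₀ z n = M z n) ∧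
      (∀ z ∉ strip R, ∀ n, M₀ z n = 0) ∧
      wnorm (mixedWeight s 1) M₀.1 ≤ ENNReal.ofReal (2 ^ (s + 1)) * kernelNorm R s M := by
  set N : Kernel d := fun z n => if z ∈ strip R then M z n else 0 with hN
  have h1 : ∀ z ∈ strip R, ∀ n, N z n = M z n := fun z hz n => if_pos hz
  have h2 : ∀ z ∉ strip R, ∀ n, N z n = 0 := fun z hz n => if_neg hz
  have h3 : wnorm (mixedWeight s 1) N ≤ ENNReal.ofReal (2 ^ (s + 1)) * kernelNorm R s M := by
    refine iSup_le fun z => ?_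
    by_cases hz : z ∈ strip R
    · rw [kernelNorm_eq]
      refine le_trans ?_ (mul_le_mul_right (le_iSup₂ (f := fun z (_ : z ∈ strip R) =>
        ∑' n, ‖M z n‖ₑ * ENNReal.ofReal (bracket n ^ s)) z hz) _)
      rw [← ENNReal.tsum_mul_left]
      refine ENNReal.tsum_le_tsum fun n => ?_
      rw [h1 z hz, mul_left_comm]
      gcongr
      rw [mixedWeight, ← ENNReal.ofReal_mul (by positivity)]
      refine ENNReal.ofReal_le_ofReal ?_
      have h4 := one_le_bracket_rpow hs n
      calc (2 : ℝ) ^ s * (1 + 1 * bracket n ^ s) ≤ 2 ^ s * (2 * bracket n ^ s) := by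
            gcongr; linarith
        _ = _ := by rw [Real.rpow_add two_pos, Real.rpow_one]; ring
    · simp [h2 z hz]
  have h4 : wnorm 1 N < ⊤ := by
    refine (wnorm_weight_mono (isWeight_mixedWeight hs zero_le_one).one_le N).trans_lt
      (h3.trans_lt ?_)
    exact ENNReal.mul_lt_top ENNReal.ofReal_lt_top hM.finite
  refine ⟨⟨N, h4⟩, fun n => ⟨(hM.hol n).holomorphic.congr fun z hz => h1 z hz n, fun z hz => ?_⟩,
    h1, h2, h3⟩
  change N (z + 1) n = N z n
  rw [h1 z hz, h1 _ (add_one_mem_strip_iff.2 hz)]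
  exact (hM.hol n).periodic z hz

lemma adjoint_cut {R : ℝ} {M : Kernel d} {M₀ : BKernel ω} (hsa : IsSelfAdjointKernel ω R M)
    (h1 : ∀ z ∈ strip R, ∀ n, M₀ z n = M z n) (h2 : ∀ z ∉ strip R, ∀ n, M₀ z n = 0) :
    adjoint ω M₀.1 = M₀.1 := by
  funext z n
  by_cases hz : z ∈ strip R
  · rw [h1 z hz, ← hsa z hz n, adjoint, adjoint,
      h1 _ ((sub_ofReal_mem_strip_iff _).2 (conj_mem_strip_iff.2 hz))]
  · rw [h2 z hz, adjoint, h2 _ (mt (fun h => conj_mem_strip_iff.1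
      ((sub_ofReal_mem_strip_iff _).1 h)) hz), map_zero]

/-- The conjugation identity at the regular phases. -/
lemma IsDiagonalization.isTripleProdOn {V : ℂ → ℂ} {r v σ C E : ℝ} {M U Uinv f : BKernel ω}
    (hD : IsDiagonalization V r v σ C E M U Uinv f) {M' : Kernel d}
    (hM : ∀ z ∈ strip r, ∀ n, M z n = M' z n) :
    IsTripleProdOn ω (regularPhases ω r V) U.1 (diag d V + M') Uinv.1
      (diag d (addHol V fun z => f z 0)) := by
  set S := regularPhases ω r V with hS
  set p := addHol V fun z => f z 0 with hp
  have hrow : ∀ z ∈ S, ∀ l, p z * U z l = U z l * V (z - (dot l ω : ℂ)) + (U * M) z l := by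
    intro z hz l
    have h1 := hD.commutator z hz l
    rw [coe_sub, Pi.sub_apply, Pi.sub_apply, hD.isDiagonal.mul_apply] at h1
    rw [hp, addHol_of_analyticAt (by simpa using hz.2 0)]
    linear_combination -h1
  have hdiag : ∀ z n, diag d p z n = p z * (1 : BKernel ω) z n := fun z n => by
    by_cases hn : n = 0 <;> simp [diag, unit, hn]
  refine ⟨⟨fun z n => p z * U z n, fun z hz n => ?_, fun z hz n => ?_⟩,
    ⟨fun z n => V z * Uinv z n + (M * Uinv) z n, fun z hz n => ?_, fun z hz n => ?_⟩⟩
  · change HasSum _ (p z * U z n)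
    rw [hrow z hz n]
    have h1 : HasSum (fun l => U z l * diag d V (z - (dot l ω : ℂ)) (n - l))
        (U z n * V (z - (dot n ω : ℂ))) := by
      convert hasSum_single (f := fun l => U z l * diag d V (z - (dot l ω : ℂ)) (n - l)) n
        (fun l hl => by simp [diag, sub_eq_zero, hl.symm]) using 1
      simp [diag]
    refine (h1.add (U.hasSum_mul M z n)).congr_fun fun l => ?_
    rw [hM _ (regularPhases_sub hz l).1, ← mul_add]
    rfl
  · have h1 := (U.hasSum_mul Uinv z n).mul_left (p z)
    rw [hD.mul_inv] at h1
    rw [hdiag]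
    refine h1.congr_fun fun l => ?_
    ring
  · have h1 : HasSum (fun l => diag d V z l * Uinv (z - (dot l ω : ℂ)) (n - l))
        (V z * Uinv z n) := by
      convert hasSum_single (f := fun l => diag d V z l * Uinv (z - (dot l ω : ℂ)) (n - l)) 0
        (fun l hl => by simp [diag, hl]) using 1
      simp [diag]
    refine (h1.add (M.hasSum_mul Uinv z n)).congr_fun fun l => ?_
    rw [hM _ hz.1, ← add_mul]
    rfl
  -- Associativity is not available for the unbounded `V`. The row identity trades `U V` for `pU -
  -- UM`, and the two bounded triple products with `M` then cancel.
  · have h1 := (((U.hasSum_mul Uinv z n).mul_left (p z)).sub ((U * M).hasSum_mul Uinv z n)).add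
      (U.hasSum_mul (M * Uinv) z n)
    rw [hD.mul_inv, mul_assoc, sub_add_cancel] at h1
    rw [hdiag]
    refine h1.congr_fun fun l => ?_
    linear_combination (-Uinv (z - (dot l ω : ℂ)) (n - l)) * hrow z hz l

lemma isSelfAdjointPotential_addHol {r R : ℝ} (hrR : r ≤ R) {V g : ℂ → ℂ}
    (hV : IsSelfAdjointPotential R V) (hg : ∀ z ∈ strip r, conj (g (conj z)) = g z) :
    IsSelfAdjointPotential r (addHol V g) := by
  intro z hz
  have hzR := strip_mono hrR hz
  by_cases h : AnalyticAt ℂ V z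
  · rw [addHol_of_analyticAt h, addHol_of_analyticAt (analyticAt_conj hV hzR h), map_add,
      hV z hzR, hg z hz]
  · have h' : ¬AnalyticAt ℂ V (conj z) := fun h1 => h (by
      simpa using analyticAt_conj hV (conj_mem_strip_iff.2 hzR) h1)
    rw [addHol_of_not_analyticAt h, addHol_of_not_analyticAt h', map_zero]

end Conclusion

end HolKernel

theorem theorem1p1 (δ α₀ α : ℝ) (hδ : 0 < δ) (hα₀ : 0 < α₀) :
    -- the constants `K₁`, `K₂` depend on `α₀`, `α`, `δ` only
    ∃ K₁ K₂ : ℝ, 0 < K₁ ∧ 0 < K₂ ∧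
    ∀ τ γ R v : ℝ, 0 < γ → 0 < R → 0 < v → α₀ + τ + 4 * δ < α →
    -- the threshold `ε₀` depends on `R, α, α₀, γ, τ, |V|_R = v, δ` only
    ∃ ε₀ : ℝ, 0 < ε₀ ∧
    ∀ (d : ℕ) (ω : Fin d → ℝ) (V : ℂ → ℂ) (M : Kernel d),
      1 ≤ d → (d : ℝ) < τ → IsDiophantine τ γ ω →
      IsMonotonePotential R V → monotoneConst R V = v →
      IsHolKernel R (α + 3 * δ) M →
      kernelNorm R (α + 3 * δ) M < ENNReal.ofReal ε₀ →
      ∃ (U Uinv : Kernel d) (Vhat : ℂ → ℂ),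
        -- `U` is an invertible element, with inverse `Uinv`
        IsHolKernel (R / 2) (α - τ - 4 * δ) U ∧
        IsHolKernel (R / 2) (α - τ - 4 * δ) Uinv ∧
        IsProdOn ω (strip (R / 2)) U Uinv (unit d) ∧
        IsProdOn ω (strip (R / 2)) Uinv U (unit d) ∧
        IsMonotonePotential (R / 2) Vhat ∧
        -- `U (V + M) U⁻¹ = Vhat`
        IsTripleProdOn ω (regularPhases ω (R / 2) V) U (diag d V + M) Uinv (diag d Vhat) ∧
        kernelNorm (R / 2) (α - τ - 4 * δ) (U - unit d) ≤
          ENNReal.ofReal K₁ * kernelNorm R (α + 3 * δ) M ^ (3 * δ / (α - α₀)) ∧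
        kernelNorm (R / 2) (α - τ - 4 * δ) (Uinv - unit d) ≤
          ENNReal.ofReal K₁ * kernelNorm R (α + 3 * δ) M ^ (3 * δ / (α - α₀)) ∧
        monotoneConst R V / 2 ≤ monotoneConst (R / 2) Vhat ∧
        -- the meromorphic function `V - Vhat` is the holomorphic function `F`
        (∃ F : ℂ → ℂ, IsHol (R / 2) F ∧
          (∀ z ∈ strip (R / 2), AnalyticAt ℂ V z → V z - Vhat z = F z) ∧
          kernelNorm (R / 2) 0 (diag d F) ≤
            ENNReal.ofReal K₂ * kernelNorm R (α + 3 * δ) M) ∧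
        (IsSelfAdjointKernel ω R M → IsSelfAdjointPotential R V →
          IsUnitaryKernel ω (R / 2) U ∧ IsSelfAdjointPotential (R / 2) Vhat) := by
  set s := α + 3 * δ with hs
  -- `K₂` combines `‖f‖ ≤ 2E` with `E = 2^(s+1) ‖M‖`. `K₁ = 1` is possible because the exponent `p`
  -- is less than one: all remaining constants go into `ε₀`.
  refine ⟨1, 2 ^ (s + 2), one_pos, by positivity, fun τ γ R v hγ hR hv hα => ?_⟩
  -- For `τ ≤ 1` the conditions `1 ≤ d < τ` are contradictory.
  rcases le_or_gt τ 1 with hτ | hτ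
  · refine ⟨1, one_pos, fun d ω V M hd hdτ => ?_⟩
    have : (1 : ℝ) ≤ d := by exact_mod_cast hd
    linarith
  set σ := α - τ - 4 * δ with hσdef
  have hσ : 0 ≤ σ := by rw [hσdef]; linarith
  have hs0 : 0 ≤ s := by rw [hs]; linarith
  -- Here `s - σ = τ + 7δ`, which leaves the margin `η = 7δ` over the loss `τ`.
  obtain ⟨C, ε, hC, hε, hmain⟩ := exists_isDiagonalization (R := R) (v := v) (s := s) (σ := σ)
    (τ := τ) (γ := γ) (η := 7 * δ) hR hv hγ hσ (by linarith) (by linarith)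
    (by rw [hs, hσdef]; ring)
  set p := 3 * δ / (α - α₀) with hp
  have hαα : 0 < α - α₀ := by linarith
  have hp0 : 0 < p := by positivity
  have hp1 : p < 1 := by rw [hp, div_lt_one hαα]; linarith
  set A : ℝ := 2 ^ (s + 1) with hA
  have hA0 : 0 < A := by positivity
  set C' := C * (1 + 12 * 2 ^ σ) with hC'
  have h2σ : (0 : ℝ) < 2 ^ σ := by positivity
  have hC'0 : 0 < C' := by positivity
  have hCC' : C ≤ C' := le_mul_of_one_le_right hC.le (by linarith)
  -- Exactly the size of `m` for which `C' A m^(1-p) ≤ 1`, which turns the linear bound `C' A m`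
  -- into `m^p`.
  set ε₁ := (1 / (C' * A)) ^ (1 / (1 - p)) with hε₁
  refine ⟨min (ε / A) (min (1 / (6 * C * A)) ε₁), by positivity,
    fun d ω V M _ _ hω hV hvV hM hMε => ?_⟩
  set m := (kernelNorm R s M).toReal with hm
  have hm0 : 0 ≤ m := ENNReal.toReal_nonneg
  have hMm : kernelNorm R s M = ENNReal.ofReal m := (ENNReal.ofReal_toReal hM.finite.ne).symm
  have hmε : m ≤ min (ε / A) (min (1 / (6 * C * A)) ε₁) := by
    rw [hMm] at hMε
    exact ((ENNReal.ofReal_lt_ofReal_iff_of_nonneg hm0).1 hMε).le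
  set E := A * m with hE
  have hE0 : 0 ≤ E := by positivity
  have hEε : E ≤ ε := by
    have := hmε.trans (min_le_left _ _)
    rwa [le_div_iff₀ hA0, mul_comm] at this
  have hCE : C * E ≤ 1 / 6 := by
    have := hmε.trans ((min_le_right _ _).trans (min_le_left _ _))
    rw [le_div_iff₀ (by positivity)] at this
    rw [hE]
    linarith
  have hC'E : C' * E ≤ m ^ p := by
    have h1 : m ^ (1 - p) ≤ 1 / (C' * A) := by
      have h2 := hmε.trans ((min_le_right _ _).trans (min_le_right _ _))
      refine (Real.rpow_le_rpow hm0 h2 (by linarith)).trans_eq ?_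
      rw [hε₁, ← Real.rpow_mul (by positivity), one_div_mul_cancel (by linarith), Real.rpow_one]
    have h3 : m = m ^ p * m ^ (1 - p) := by
      rw [← Real.rpow_add' hm0 (by norm_num)]
      norm_num
    rw [le_div_iff₀ (by positivity)] at h1
    calc C' * E = m ^ p * (m ^ (1 - p) * (C' * A)) := by
          rw [hE]; nth_rewrite 1 [h3]; ring
      _ ≤ m ^ p * 1 := by gcongr
      _ = _ := mul_one _
  obtain ⟨M₀, hM₀hol, hM₀eq, hM₀zero, hM₀le⟩ := exists_cut (ω := ω) hs0 hM
  rw [hMm, ← ENNReal.ofReal_mul hA0.le, ← hE] at hM₀le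
  have hVm := hV.meromorphic.meromorphicOn
  have hmono : ∀ z ∈ strip R, ∀ a : ℝ, AnalyticAt ℂ V z → AnalyticAt ℂ V (z - a) →
      v * torusNorm a ≤ ‖V z - V (z - a)‖ := fun z hz a h1 h2 =>
    hvV ▸ monotoneConst_mul_le hV.monotone hz a h1 h2
  have hRR : R / 2 ≤ R := by linarith
  obtain ⟨U₀, Uinv₀, f, hD₀⟩ := hmain d ω V M₀ E hE0 hEε hω.2 hVm hV.periodic hmono hM₀hol hM₀le
  obtain ⟨U, Uinv, hD, hsa⟩ : ∃ U Uinv : BKernel ω,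
      IsDiagonalization V (R / 2) v σ C' E M₀ U Uinv f ∧
      (IsSelfAdjointKernel ω R M → IsSelfAdjointPotential R V →
        IsUnitaryKernel ω (R / 2) U.1 ∧ ∀ z ∈ strip (R / 2), conj (f (conj z) 0) = f z 0) := by
    by_cases h : IsSelfAdjointKernel ω R M ∧ IsSelfAdjointPotential R V
    · obtain ⟨U, Uinv, h1, h2⟩ := hD₀.exists_unitary hv hγ hσ hRR hVm hmono hω.2 h.2
        (adjoint_cut h.1 hM₀eq hM₀zero) (by positivity) hCE
      exact ⟨U, Uinv, h1, fun _ _ => h2⟩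
    · have h1 : ENNReal.ofReal (C * E) ≤ ENNReal.ofReal (C' * E) :=
        ENNReal.ofReal_le_ofReal (by gcongr)
      exact ⟨U₀, Uinv₀, { hD₀ with
        wnorm_le := hD₀.wnorm_le.trans h1
        wnorm_inv_le := hD₀.wnorm_inv_le.trans h1 }, fun h2 h3 => absurd ⟨h2, h3⟩ h⟩
  have hbound : ∀ B : BKernel ω, wnorm (powWeight σ) (B - 1).1 ≤ ENNReal.ofReal (C' * E) →
      kernelNorm (R / 2) σ (B.1 - unit d) ≤ ENNReal.ofReal 1 * kernelNorm R s M ^ p := by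
    intro B hB
    have h1 := (kernelNorm_le_wnorm hσ (R / 2) (B - 1).1).trans hB
    rw [BKernel.coe_sub, BKernel.coe_one] at h1
    refine h1.trans ?_
    rw [ENNReal.ofReal_one, one_mul, hMm, ENNReal.ofReal_rpow_of_nonneg hm0 hp0.le]
    exact ENNReal.ofReal_le_ofReal hC'E
  have hfhol := hD.hol_potential 0
  have hpot := isMonotonePotential_addHol (half_pos hR) hRR hv hV hvV hfhol.1 hfhol.2 hD.lipschitz
  refine ⟨U.1, Uinv.1, addHol V fun z => f z 0, isHolKernel_of_mem hσ hD.hol hD.wnorm_le,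
    isHolKernel_of_mem hσ hD.hol_inv hD.wnorm_inv_le, fun z _ n => ?_, fun z _ n => ?_, hpot.1,
    hD.isTripleProdOn fun z hz n => hM₀eq z (strip_mono hRR hz) n, hbound U hD.wnorm_le,
    hbound Uinv hD.wnorm_inv_le, hvV ▸ hpot.2, ⟨fun z => -f z 0, ⟨?_, ?_, ?_⟩, ?_, ?_⟩, ?_⟩
  · simpa [hD.mul_inv] using! U.hasSum_mul Uinv z n
  · simpa [hD.inv_mul] using! Uinv.hasSum_mul U z n
  · exact fun z hz => congrArg (- ·) (hfhol.2 z hz)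
  · exact hfhol.1.neg
  · exact ⟨‖f‖, fun z _ => by rw [norm_neg]; exact f.entry_le_norm z 0⟩
  · intro z _ h
    rw [addHol_of_analyticAt h]
    ring
  · rw [kernelNorm_eq]
    refine iSup₂_le fun z _ => ?_
    simp only [Real.rpow_zero]
    rw [row_diag, hMm, ← ENNReal.ofReal_mul (by positivity), ENNReal.ofReal_one, mul_one,
      ← ofReal_norm, norm_neg]
    refine ENNReal.ofReal_le_ofReal ((f.entry_le_norm z 0).trans (hD.potential_le.trans_eq ?_))
    rw [hE, hA, show s + 2 = s + 1 + 1 by ring, Real.rpow_add two_pos (s + 1), Real.rpow_one]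
    ring
  · intro h1 h2
    exact ⟨(hsa h1 h2).1, isSelfAdjointPotential_addHol hRR h2 (hsa h1 h2).2⟩
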